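/- Let $G$ be a finite-dimensional real Lie group with identity component $G_0$ (an open normal subgroup), $\pi_0(G)=G/G_0$, Lie algebra $\mathfrak g=T_1G$, abelianisation $\mathfrak a=\mathfrak g^{ab}=\mathfrak g/[\mathfrak g,\mathfrak g]$ and projection $q\colon\mathfrak g\to\mathfrak a$. A smooth 2-form $\eta$ on a Lie group is bi-invariant if $L_g^*\eta=\eta=R_g^*\eta$ for every $g$; write $\Omega^2_I$ for the vector space of bi-invariant 2-forms and $\bigwedge^2\mathfrak a^*$ for the space of alternating bilinear forms on $\mathfrak a$. Then: (i) The adjoint action of $G$ on $\mathfrak g$ induces a linear action of $\pi_0(G)$ on $\mathfrak a$: there is a representation $\rho$ of $\pi_0(G)$ on $\mathfrak a$ with $\rho(gG_0)(q(X))=q(\mathrm{Ad}_gX)$ for all $g\in G$, $X\in\mathfrak g$. Let $\pi_0(G)$ act on $\bigwedge^2\mathfrak a^*$ by $(\gamma\cdot\lambda)(v,w)=\lambda(\rho(\gamma^{-1})v,\rho(\gamma^{-1})w)$. (ii) There are linear isomorphisms $$\Phi\colon\Omega^2_I(G)\xrightarrow{\ \simeq\ }\Big(\bigwedge\nolimits^2\mathfrak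 a^*\Big)^{\mathrm{Ad}(\pi_0(G))},\qquad \Phi_0\colon\Omega^2_I(G_0)\xrightarrow{\ \simeq\ }\bigwedge\nolimits^2\mathfrak a^*,$$ given by $\Phi(\eta)(q(X),q(Y))=\eta_1(X,Y)$ for $X,Y\in\mathfrak g$, and $\Phi_0(\eta)(q(d\iota\,X),q(d\iota\,Y))=\eta_1(X,Y)$ for $X,Y\in T_1G_0$, where $d\iota\colon T_1G_0\to T_1G$ is the derivative at $1$ of the inclusion $\iota\colon G_0\to G$. (iii) Under these isomorphisms the restriction map $\iota^*\colon\Omega^2_I(G)\to\Omega^2_I(G_0)$ is the subspace inclusion $(\bigwedge^2\mathfrak a^*)^{\mathrm{Ad}(\pi_0(G))}\hookrightarrow\bigwedge^2\mathfrak a^*$; that is, $\Phi_0(\iota^*\eta)=\Phi(\eta)$ for all $\eta\in\Omega^2_I(G)$. -/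

import Mathlib

open scoped Manifold ContDiff Bundle

noncomputable section

namespace BiInv

section Forms

variable {E : Type*} [NormedAddCommGroup E] [NormedSpace ℝ E]
  {H : Type*} [TopologicalSpace H] (I : ModelWithCorners ℝ E H)
  {E' : Type*} [NormedAddCommGroup E'] [NormedSpace ℝ E']
  {H' : Type*} [TopologicalSpace H'] (I' : ModelWithCorners ℝ E' H')
  {E'' : Type*} [NormedAddCommGroup E''] [NormedSpace ℝ E'']
  {H'' : Type*} [TopologicalSpace H''] (I'' : ModelWithCorners ℝ E'' H'')
  (M : Type*) [TopologicalSpace M] [ChartedSpace H M] [IsManifold I ∞ M]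
  (N : Type*) [TopologicalSpace N] [ChartedSpace H' N] [IsManifold I' ∞ N]
  (P : Type*) [TopologicalSpace P] [ChartedSpace H'' P] [IsManifold I'' ∞ P]

instance (x : M) : IsTopologicalAddGroup (TangentSpace I x →L[ℝ] ℝ) :=
  ContinuousLinearMap.topologicalAddGroup

instance (x : M) : ContinuousSMul ℝ (TangentSpace I x →L[ℝ] ℝ) :=
  ContinuousLinearMap.continuousSMul

instance (x : M) : ContinuousAdd (TangentSpace I x →L[ℝ] ℝ) :=
  IsTopologicalAddGroup.toContinuousAdd

instance (x : M) : ContinuousConstSMul ℝ (TangentSpace I x →L[ℝ] ℝ) :=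
  ContinuousSMul.continuousConstSMul

/-- Smooth fields of bilinear forms on the tangent spaces of `M`: smooth sections of the
bundle `Hom(TM, Hom(TM, ℝ))`. -/
abbrev BilinField : Type _ :=
  ContMDiffSection I (E →L[ℝ] E →L[ℝ] ℝ) ∞
    (fun x : M ↦ TangentSpace I x →L[ℝ] TangentSpace I x →L[ℝ] ℝ)

instance : AddCommGroup (BilinField I M) := ContMDiffSection.instAddCommGroup

instance : Module ℝ (BilinField I M) := ContMDiffSection.instModule

/-- The space `Ω²(M)` of smooth differential 2-forms: the smooth fields of bilinear forms
that are alternating at every point. -/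
def TwoForm : Submodule ℝ (BilinField I M) where
  carrier := {η | ∀ (x : M) (v : TangentSpace I x), η x v v = 0}
  add_mem' := by
    intro a b ha hb x v
    simp [ha x v, hb x v]
  zero_mem' := by
    intro x v
    simp
  smul_mem' := by
    intro c a ha x v
    simp [ha x v]

instance : AddCommGroup (TwoForm I M) := Submodule.addCommGroup _

instance : Module ℝ (TwoForm I M) := Submodule.module _

variable {I I' M N}

/-- The field `x ↦ η (f x) (df ·) (df ·)`. -/
def pullbackFun (f : M → N) (η : ∀ y : N, TangentSpace I' y →L[ℝ] TangentSpace I' y →L[ℝ] ℝ)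
    (x : M) : TangentSpace I x →L[ℝ] TangentSpace I x →L[ℝ] ℝ :=
  (ContinuousLinearMap.precomp ℝ (mfderiv I I' f x)).comp ((η (f x)).comp (mfderiv I I' f x))

set_option synthInstance.maxHeartbeats 400000 in
set_option maxHeartbeats 1000000 in
theorem pullbackFun_smooth (f : ContMDiffMap I I' M N ∞) (η : BilinField I' N) :
    ContMDiff I (I.prod 𝓘(ℝ, E →L[ℝ] E →L[ℝ] ℝ)) ∞
      (fun x ↦ Bundle.TotalSpace.mk' (E →L[ℝ] E →L[ℝ] ℝ)
        (E := fun x : M ↦ TangentSpace I x →L[ℝ] TangentSpace I x →L[ℝ] ℝ)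
        x (pullbackFun f η x)) := by
  intro x₀
  rw [contMDiffAt_hom_bundle]
  refine ⟨contMDiffAt_id, ?_⟩
  have hη := (contMDiffAt_hom_bundle _).1 (η.contMDiff (f x₀))
  have hη' := hη.2.comp x₀ f.contMDiff.contMDiffAt
  have hA : ContMDiffAt I 𝓘(ℝ, E →L[ℝ] E') ∞
      (inTangentCoordinates I I' id f (mfderiv I I' f) x₀) x₀ :=
    (f.contMDiff x₀).mfderiv_const (m := ∞) (by simp)
  let T : (E →L[ℝ] E') →L[ℝ] ((E' →L[ℝ] ℝ) →L[ℝ] (E →L[ℝ] ℝ)) :=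
    (ContinuousLinearMap.compL ℝ E E' ℝ).flip
  have hT : ContMDiff 𝓘(ℝ, E →L[ℝ] E') 𝓘(ℝ, (E' →L[ℝ] ℝ) →L[ℝ] (E →L[ℝ] ℝ)) ∞ T := by
    rw [contMDiff_iff_contDiff]
    exact ContinuousLinearMap.contDiff (𝕜 := ℝ) (E := E →L[ℝ] E')
      (F := (E' →L[ℝ] ℝ) →L[ℝ] (E →L[ℝ] ℝ)) T
  have hB : ContMDiffAt I 𝓘(ℝ, (E' →L[ℝ] ℝ) →L[ℝ] (E →L[ℝ] ℝ)) ∞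
      (fun x ↦ T (inTangentCoordinates I I' id f (mfderiv I I' f) x₀ x)) x₀ :=
    ContMDiffAt.comp x₀ hT.contMDiffAt hA
  have key := hB.clm_comp (hη'.clm_comp hA)
  refine key.congr_of_eventuallyEq ?_
  have h1 : ∀ᶠ x in nhds x₀, x ∈ (trivializationAt E (TangentSpace I) x₀).baseSet :=
    (trivializationAt E (TangentSpace I) x₀).open_baseSet.mem_nhds
      (FiberBundle.mem_baseSet_trivializationAt' x₀)
  have h2 : ∀ᶠ x in nhds x₀, f x ∈ (trivializationAt E' (TangentSpace I') (f x₀)).baseSet :=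
    f.contMDiff.continuous.continuousAt.eventually
      ((trivializationAt E' (TangentSpace I') (f x₀)).open_baseSet.mem_nhds
        (FiberBundle.mem_baseSet_trivializationAt' (f x₀)))
  filter_upwards [h1, h2] with x hx hfx
  ext v w
  rw [inCoordinates_apply_eq₂ hx hx (Set.mem_univ _)]
  have e := inCoordinates_apply_eq₂ (𝕜 := ℝ) (F₁ := E') (E₁ := fun y : N ↦ TangentSpace I' y)
    (F₂ := E') (E₂ := fun y : N ↦ TangentSpace I' y) (F₃ := ℝ) (E₃ := fun _ : N ↦ ℝ)
    (ϕ := η (f x)) (v := inTangentCoordinates I I' id f (mfderiv I I' f) x₀ x v)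
    (w := inTangentCoordinates I I' id f (mfderiv I I' f) x₀ x w) hfx hfx (Set.mem_univ _)
  refine Eq.trans ?_ e.symm
  have hc : ∀ u : E, (trivializationAt E' (TangentSpace I') (f x₀)).symm (f x)
      (inTangentCoordinates I I' id f (mfderiv I I' f) x₀ x u) =
      mfderiv I I' f x ((trivializationAt E (TangentSpace I) x₀).symm x u) := by
    intro u
    rw [← Bundle.Trivialization.symmL_apply (R := ℝ) _ hx u,
      ← Bundle.Trivialization.symmL_apply (R := ℝ) _ hfx]
    exact (trivializationAt E' (TangentSpace I') (f x₀)).symmL_continuousLinearMapAt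
      (R := ℝ) hfx _
  rw [hc v, hc w]
  rfl

/-- The pullback `f^* : Ω²(N) → Ω²(M)` along a smooth map `f : M → N`. -/
def pullback (f : ContMDiffMap I I' M N ∞) : TwoForm I' N →ₗ[ℝ] TwoForm I M where
  toFun η := ⟨⟨pullbackFun f η.1, pullbackFun_smooth f η.1⟩, fun x _ ↦ η.2 (f x) _⟩
  map_add' _ _ := rfl
  map_smul' _ _ := rfl

theorem pullback_apply (f : ContMDiffMap I I' M N ∞) (η : TwoForm I' N) (x : M)
    (v w : TangentSpace I x) :
    (pullback f η).1 x v w = η.1 (f x) (mfderiv I I' f x v) (mfderiv I I' f x w) := rfl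

variable {I'' P}

theorem pullback_pullback (f : ContMDiffMap I I' M N ∞) (g : ContMDiffMap I' I'' N P ∞)
    (h : ContMDiffMap I I'' M P ∞) (hh : ∀ x, h x = g (f x)) (η : TwoForm I'' P) :
    pullback f (pullback g η) = pullback h η := by
  obtain rfl : h = g.comp f := ContMDiffMap.ext hh
  refine Subtype.ext (ContMDiffSection.ext fun x ↦ ?_)
  ext v w
  change η.1 (g (f x)) _ _ = η.1 (g (f x)) _ _
  have : mfderiv I I'' (g.comp f) x = (mfderiv I' I'' g (f x)).comp (mfderiv I I' f x) :=
    mfderiv_comp x (g.contMDiff.mdifferentiableAt (by simp))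
      (f.contMDiff.mdifferentiableAt (by simp))
  rw [this]
  rfl

end Forms

section Invariant

variable {E : Type*} [NormedAddCommGroup E] [NormedSpace ℝ E]
  {H : Type*} [TopologicalSpace H] (I : ModelWithCorners ℝ E H)
  (G : Type*) [TopologicalSpace G] [ChartedSpace H G] [Group G] [LieGroup I ∞ G]

/-- The space `Ω²_I(G)` of bi-invariant 2-forms: those with `L_g^* η = η = R_g^* η`
for all `g`. -/
def BiInvariantTwoForm : Submodule ℝ (TwoForm I G) where
  carrier := {η | ∀ g : G, pullback (smoothLeftMul I g) η = η ∧
    pullback (smoothRightMul I g) η = η}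
  add_mem' := by
    intro a b ha hb g
    exact ⟨((pullback (smoothLeftMul I g)).map_add a b).trans (by rw [(ha g).1, (hb g).1]),
      ((pullback (smoothRightMul I g)).map_add a b).trans (by rw [(ha g).2, (hb g).2])⟩
  zero_mem' := by
    intro g
    exact ⟨LinearMap.map_zero _, LinearMap.map_zero _⟩
  smul_mem' := by
    intro c a ha g
    exact ⟨((pullback (smoothLeftMul I g)).map_smul c a).trans (by rw [(ha g).1]),
      ((pullback (smoothRightMul I g)).map_smul c a).trans (by rw [(ha g).2])⟩

end Invariant

section LieAlgebra

instance finiteDimensional_completeSpace {E : Type*} [NormedAddCommGroup E] [NormedSpace ℝ E]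
    [FiniteDimensional ℝ E] : CompleteSpace E := FiniteDimensional.complete ℝ E

variable {E : Type*} [NormedAddCommGroup E] [NormedSpace ℝ E]
  {H : Type*} [TopologicalSpace H] (I : ModelWithCorners ℝ E H)
  (G : Type*) [TopologicalSpace G] [ChartedSpace H G] [Group G] [LieGroup I ∞ G]

instance : LieGroup I (minSmoothness ℝ 3) G :=
  LieGroup.of_le (m := minSmoothness ℝ 3) (n := ∞) (by
    rw [minSmoothness_of_isRCLikeNormedField]
    exact ENat.LEInfty.out)

/-- The abelianisation `𝔤/[𝔤, 𝔤]` of the Lie algebra `𝔤 = T_1 G`. -/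
abbrev LieAb [CompleteSpace E] : Type _ :=
  GroupLieAlgebra I G ⧸ (⁅(⊤ : LieIdeal ℝ (GroupLieAlgebra I G)),
    (⊤ : LieIdeal ℝ (GroupLieAlgebra I G))⁆ : LieIdeal ℝ (GroupLieAlgebra I G))

/-- The projection `q : 𝔤 → 𝔤/[𝔤, 𝔤]`. -/
def toLieAb [CompleteSpace E] : GroupLieAlgebra I G →ₗ[ℝ] LieAb I G :=
  (LieSubmodule.Quotient.mk' _ : GroupLieAlgebra I G →ₗ⁅ℝ, GroupLieAlgebra I G⁆ LieAb I G)

variable {G}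

/-- The adjoint action `Ad_g : 𝔤 → 𝔤`, the derivative at `1` of `h ↦ g h g⁻¹`. The type ascription
only identifies the tangent space at `g * 1 * g⁻¹` with the one at the equal point `1`. -/
def Ad (g : G) : GroupLieAlgebra I G →L[ℝ] GroupLieAlgebra I G :=
  (mfderiv I I (fun h : G ↦ g * h * g⁻¹) 1 : E →L[ℝ] E)

end LieAlgebra

section Alternating

variable {Γ V : Type*} [Group Γ] [AddCommGroup V] [Module ℝ V]

/-- The representation of `Γ` on the space `⋀²V*` of alternating bilinear forms on `V` induced
by a representation on `V`: `(γ · lam)(v, w) = lam(γ⁻¹ v, γ⁻¹ w)`. -/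
def altRep (ρ : Representation ℝ Γ V) : Representation ℝ Γ (V [⋀^Fin 2]→ₗ[ℝ] ℝ) where
  toFun γ :=
    { toFun := fun lam ↦ lam.compLinearMap (ρ γ⁻¹)
      map_add' := fun _ _ ↦ rfl
      map_smul' := fun _ _ ↦ rfl }
  map_one' := by
    ext lam v
    simp
  map_mul' a b := by
    ext lam v
    rw [mul_inv_rev, map_mul]
    rfl

end Alternating

section Component

variable (E : Type*) [NormedAddCommGroup E] [NormedSpace ℝ E]
  (G : Type*) [TopologicalSpace G] [ChartedSpace E G] [Group G] [LieGroup 𝓘(ℝ, E) ∞ G]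

/-- The identity component `G₀` of a Lie group `G`. -/
def idComponent : Subgroup G :=
  have : IsTopologicalGroup G := topologicalGroup_of_lieGroup 𝓘(ℝ, E) ∞
  Subgroup.connectedComponentOfOne G

theorem coe_idComponent : (idComponent E G : Set G) = connectedComponent (1 : G) := rfl

instance : (idComponent E G).Normal where
  conj_mem n hn g := by
    have : IsTopologicalGroup G := topologicalGroup_of_lieGroup 𝓘(ℝ, E) ∞
    have hc : Continuous fun h : G ↦ g * h * g⁻¹ := by fun_prop
    have := hc.image_connectedComponent_subset 1 ⟨n, hn, rfl⟩
    rw [mul_one, mul_inv_cancel] at this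
    exact this

theorem isOpen_idComponent : IsOpen (idComponent E G : Set G) := by
  have : LocallyConnectedSpace G := ChartedSpace.locallyConnectedSpace E G
  exact isOpen_connectedComponent

/-- The identity component as an open subset. -/
def idComponentOpens : TopologicalSpace.Opens G := ⟨idComponent E G, isOpen_idComponent E G⟩

/-- `G₀` carries the smooth structure of an open subset of `G`. -/
instance : ChartedSpace E (idComponent E G) :=
  inferInstanceAs (ChartedSpace E (idComponentOpens E G))

instance : IsManifold 𝓘(ℝ, E) ∞ (idComponent E G) :=
  inferInstanceAs (IsManifold 𝓘(ℝ, E) ∞ (idComponentOpens E G))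

theorem contMDiff_idComponent_val :
    ContMDiff 𝓘(ℝ, E) 𝓘(ℝ, E) ∞ (Subtype.val : idComponent E G → G) :=
  contMDiff_subtype_val (U := idComponentOpens E G)

/-- `G₀` is a Lie group. -/
instance : LieGroup 𝓘(ℝ, E) ∞ (idComponent E G) where
  contMDiff_mul := by
    have h := contMDiff_idComponent_val E G
    refine (ContMDiff.subtypeVal_comp_iff (idComponentOpens E G)
      (fun p : idComponent E G × idComponent E G ↦ p.1 * p.2)).1 ?_
    exact (h.comp contMDiff_fst).mul (h.comp contMDiff_snd)
  contMDiff_inv := by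
    have h := contMDiff_idComponent_val E G
    refine (ContMDiff.subtypeVal_comp_iff (idComponentOpens E G)
      (fun p : idComponent E G ↦ (p⁻¹ : idComponent E G))).1 ?_
    exact h.inv

/-- The inclusion `G₀ → G`. -/
def idComponentIncl : ContMDiffMap 𝓘(ℝ, E) 𝓘(ℝ, E) (idComponent E G) G ∞ :=
  ⟨Subtype.val, contMDiff_idComponent_val E G⟩

/-- The restriction map `Ω²_I(G) → Ω²_I(G₀)`: pullback along the inclusion. -/
def restrict : BiInvariantTwoForm 𝓘(ℝ, E) G →ₗ[ℝ] BiInvariantTwoForm 𝓘(ℝ, E) (idComponent E G) :=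
  (pullback (idComponentIncl E G)).restrict (by
    intro η hη g
    let ι := idComponentIncl E G
    constructor
    · rw [pullback_pullback _ ι ((smoothLeftMul 𝓘(ℝ, E) (g : G)).comp ι) (fun _ ↦ rfl),
        ← pullback_pullback ι (smoothLeftMul 𝓘(ℝ, E) (g : G)) _ (fun _ ↦ rfl), (hη g).1]
    · rw [pullback_pullback _ ι ((smoothRightMul 𝓘(ℝ, E) (g : G)).comp ι) (fun _ ↦ rfl),
        ← pullback_pullback ι (smoothRightMul 𝓘(ℝ, E) (g : G)) _ (fun _ ↦ rfl), (hη g).2])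

end Component

end BiInv

end

/-!
A left-invariant 2-form is determined by its value `β` at `1`, and every alternating form `β` on
`𝔤` arises in this way (`leftInvForm`, `eq_leftInvForm`). Right translation by `g` changes `β` to
`β ∘ (Ad g⁻¹ × Ad g⁻¹)`, so bi-invariant 2-forms correspond to `Ad`-invariant alternating forms
on `𝔤` (`leftInvForm_mem_iff`). It remains to see that these are the `π₀(G)`-invariant alternating
forms on `𝔞 = 𝔤/[𝔤, 𝔤]`.

The analytic input is that the derivative of `g ↦ Ad g X` at `1` in the direction `Z` is `⁅Z, X⁆`
(`derivOne_AdModel_apply`). It is computed in the chart at `1`, where both sides come from the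
mixed second derivative of the group law. It has three consequences.

* `Ad g` is a Lie algebra endomorphism (`AdModel_lieModel`), so it acts on `𝔞`.
* A linear functional on `𝔤` killing all brackets is constant along `g ↦ Ad g X` on the identity
  component `G₀`, because this function has derivative zero everywhere
  (`AdModel_apply_of_mem_idComponent`). So `G₀` acts trivially on `𝔞`, which gives the
  representation of `π₀(G)`, and every alternating form on `𝔞` is `Ad(G₀)`-invariant.
* An `Ad(G₀)`-invariant alternating form satisfies `β(⁅Z, X⁆, Y) + β(X, ⁅Z, Y⁆) = 0`. Hence
  `β(⁅Z, X⁆, Y)` is antisymmetric in `Z, X` and symmetric in `X, Y`, so it vanishes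
  (`map_lieModel_eq_zero_of_invariant`), and `β` descends to `𝔞` (`exists_pullForm_eq`).

For `G₀` only its adjoint action is needed, and the derivative of the inclusion `G₀ → G` carries it
to that of `G`; the Lie bracket of `G₀` plays no role.

Tangent spaces of `G` are by definition copies of the model space `E`. Maps such as `Ad g` and the
bracket are restated below as maps on `E` (`AdModel`, `lieModel`, `derivOne`, `formAtOne`), so that
the calculus of normed spaces applies to them.
-/

noncomputable section

namespace BiInv

/-! ### Locally constant functions, and the second derivative of a local group law -/

theorem isLocallyConstant_of_hasMFDerivAt_zero {E : Type*} [NormedAddCommGroup E]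
    [NormedSpace ℝ E] {M : Type*} [TopologicalSpace M] [ChartedSpace E M] [IsManifold 𝓘(ℝ, E) 1 M]
    {F : Type*} [NormedAddCommGroup F] [NormedSpace ℝ F] {f : M → F}
    (hf : ∀ x, HasMFDerivAt 𝓘(ℝ, E) 𝓘(ℝ, F) f x (0 : E →L[ℝ] F)) : IsLocallyConstant f := by
  refine (IsLocallyConstant.iff_eventually_eq f).2 fun x ↦ ?_
  obtain ⟨r, hr, hrt⟩ := Metric.mem_nhds_iff.1 (extChartAt_target_mem_nhds (I := 𝓘(ℝ, E)) x)
  have hd (y : E) (hy : y ∈ Metric.ball (extChartAt 𝓘(ℝ, E) x x) r) :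
      HasFDerivAt (f ∘ (extChartAt 𝓘(ℝ, E) x).symm) (0 : E →L[ℝ] F) y := by
    have h1 : MDifferentiableAt 𝓘(ℝ, E) 𝓘(ℝ, E) (extChartAt 𝓘(ℝ, E) x).symm y :=
      ((contMDiffOn_extChartAt_symm (n := 1) x).contMDiffAt
        (extChartAt_target_mem_nhds' (hrt hy))).mdifferentiableAt (by simp)
    have h2 := (hf ((extChartAt 𝓘(ℝ, E) x).symm y)).comp y h1.hasMFDerivAt
    have h3 := h2.hasFDerivAt
    exact h3.congr_fderiv (ContinuousLinearMap.zero_comp _)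
  have hc : ∀ y ∈ Metric.ball (extChartAt 𝓘(ℝ, E) x x) r,
      (f ∘ (extChartAt 𝓘(ℝ, E) x).symm) y =
        (f ∘ (extChartAt 𝓘(ℝ, E) x).symm) (extChartAt 𝓘(ℝ, E) x x) := fun y hy ↦
    Metric.isOpen_ball.is_const_of_fderiv_eq_zero (convex_ball _ _).isPreconnected
      (fun z hz ↦ (hd z hz).differentiableAt.differentiableWithinAt)
      (fun z hz ↦ (hd z hz).fderiv) hy (Metric.mem_ball_self hr)
  filter_upwards [extChartAt_source_mem_nhds (I := 𝓘(ℝ, E)) x,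
    (continuousAt_extChartAt (I := 𝓘(ℝ, E)) x).preimage_mem_nhds (Metric.ball_mem_nhds _ hr)]
    with y hy hy'
  have := hc _ hy'
  simpa only [Function.comp_apply, (extChartAt 𝓘(ℝ, E) x).left_inv hy, extChartAt_to_inv]
    using this

section Calculus
variable {E : Type*} [NormedAddCommGroup E] [NormedSpace ℝ E]

/-- The infinitesimal identity behind `d(Ad)(Z) X = ⁅Z, X⁆`. Here `m` is a local group law with unit
`p`, and `a x` is `Ad x X`, characterised by `d(L_x) X = d(R_x) (Ad x X)`. Differentiating this
relation and using the symmetry of the second derivative of `m` gives the claim; the right-hand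
side is the bracket at `p` of the left-invariant vector fields of `m`. -/
theorem fderiv_eq_sub_of_fderiv_mul {m : E × E → E} {p : E} {a : E → E} {X : E}
    (hm : ContDiffAt ℝ 2 m (p, p)) (hm₁ : ∀ᶠ x in nhds p, m (x, p) = x)
    (ha : DifferentiableAt ℝ a p) (hap : a p = X)
    (h : ∀ᶠ x in nhds p, fderiv ℝ m (x, p) (0, X) = fderiv ℝ m (p, x) (a x, 0)) (Z : E) :
    fderiv ℝ a p Z = fderiv ℝ (fun x ↦ fderiv ℝ m (x, p) (0, X)) p Z -
      fderiv ℝ (fun x ↦ fderiv ℝ m (x, p) (0, Z)) p X := by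
  have hF : DifferentiableAt ℝ (fderiv ℝ m) (p, p) :=
    (hm.fderiv_right (m := 1) (by norm_num)).differentiableAt (by norm_num)
  have hsymm : IsSymmSndFDerivAt ℝ m (p, p) := hm.isSymmSndFDerivAt (by simp)
  have hleft : HasFDerivAt (fun x : E ↦ (x, p)) (ContinuousLinearMap.inl ℝ E E) p :=
    hasFDerivAt_prodMk_left p p
  have hright : HasFDerivAt (fun x : E ↦ (p, x)) (ContinuousLinearMap.inr ℝ E E) p :=
    hasFDerivAt_prodMk_right p p
  have h1 (v : E × E) (W : E) : fderiv ℝ (fun x ↦ fderiv ℝ m (x, p) v) p W =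
      fderiv ℝ (fderiv ℝ m) (p, p) (W, 0) v := by
    have := (HasFDerivAt.comp (f := fun x ↦ (x, p)) p hF.hasFDerivAt hleft).clm_apply
      (hasFDerivAt_const v p)
    refine (congrArg (fun T : E →L[ℝ] E ↦ T W) (HasFDerivAt.fderiv this)).trans ?_
    simp
  -- Only `m (x, p) = x` is used: it gives the first partial derivative of `m` at `(p, p)`.
  have hm₁' (W : E) : fderiv ℝ m (p, p) (W, 0) = W := by
    have h0 : HasFDerivAt (fun x ↦ m (x, p)) (ContinuousLinearMap.id ℝ E) p :=
      (hasFDerivAt_id p).congr_of_eventuallyEq hm₁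
    have := HasFDerivAt.comp (f := fun x ↦ (x, p)) p
      (hm.differentiableAt (by norm_num)).hasFDerivAt hleft
    have := congrArg (fun T ↦ T W) (h0.unique this)
    simpa using this.symm
  -- Differentiate the right-hand side of `h` by the product rule.
  have h2 : fderiv ℝ (fun x ↦ fderiv ℝ m (x, p) (0, X)) p Z =
      fderiv ℝ (fderiv ℝ m) (p, p) (0, Z) (X, 0) + fderiv ℝ a p Z := by
    rw [Filter.EventuallyEq.fderiv_eq h]
    have := (hF.hasFDerivAt.comp p hright).clm_apply
      (ha.hasFDerivAt.prodMk (hasFDerivAt_const (0 : E) p))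
    refine (congrArg (fun T : E →L[ℝ] E ↦ T Z) (HasFDerivAt.fderiv this)).trans ?_
    simp [hap, hm₁', add_comm]
  rw [h2, h1, hsymm.eq (X, 0) (0, Z)]
  abel

end Calculus

/-! ### The group law in the chart at `1` -/

section ChartAtOne
variable {E : Type*} [NormedAddCommGroup E] [NormedSpace ℝ E]
  {G : Type*} [TopologicalSpace G] [ChartedSpace E G] [Group G]

variable (E G) in
/-- The multiplication of `G`, read in the preferred chart at `1`. -/
def chartMul (q : E × E) : E :=
  extChartAt 𝓘(ℝ, E) (1 : G) ((extChartAt 𝓘(ℝ, E) (1 : G)).symm q.1 *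
    (extChartAt 𝓘(ℝ, E) (1 : G)).symm q.2)

variable (E G) in
/-- The coordinates of the identity element in its preferred chart. -/
def chartOne : E := extChartAt 𝓘(ℝ, E) (1 : G) 1

theorem extChartAt_symm_chartOne :
    (extChartAt 𝓘(ℝ, E) (1 : G)).symm (chartOne E G) = 1 :=
  extChartAt_to_inv 1

/-- The derivative at `1` of a vector-valued function on `G`, read on the model space. -/
def derivOne (f : G → E) : E →L[ℝ] E := mfderiv 𝓘(ℝ, E) 𝓘(ℝ, E) f 1

theorem hasFDerivAt_comp_extChartAt_symm {f : G → E}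
    (hf : MDifferentiableAt 𝓘(ℝ, E) 𝓘(ℝ, E) f 1) :
    HasFDerivAt (fun x ↦ f ((extChartAt 𝓘(ℝ, E) (1 : G)).symm x)) (derivOne f)
      (chartOne E G) := by
  have := hf.hasMFDerivAt.2
  rw [ModelWithCorners.range_eq_univ] at this
  exact hasFDerivWithinAt_univ.1 this

theorem eventually_mem_target : ∀ᶠ x in nhds (chartOne E G),
    x ∈ (extChartAt 𝓘(ℝ, E) (1 : G)).target :=
  extChartAt_target_mem_nhds 1

theorem hasMFDerivAt_clm_comp {F : Type*} [NormedAddCommGroup F] [NormedSpace ℝ F]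
    (L : E →L[ℝ] F) {f : G → E} (hf : MDifferentiableAt 𝓘(ℝ, E) 𝓘(ℝ, E) f 1) :
    HasMFDerivAt 𝓘(ℝ, E) 𝓘(ℝ, F) (fun g ↦ L (f g)) 1 (L.comp (derivOne f) : E →L[ℝ] F) :=
  HasMFDerivAt.comp (1 : G) (ContinuousLinearMap.hasMFDerivAt (E := E) L) hf.hasMFDerivAt

end ChartAtOne

/-! ### The adjoint action and its derivative -/

section Adjoint
variable {E : Type*} [NormedAddCommGroup E] [NormedSpace ℝ E]
  {G : Type*} [TopologicalSpace G] [ChartedSpace E G] [Group G] [LieGroup 𝓘(ℝ, E) ∞ G]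

theorem mdifferentiable_mul_left (g : G) :
    MDifferentiable 𝓘(ℝ, E) 𝓘(ℝ, E) (fun x : G ↦ g * x) :=
  (contMDiff_mul_left (I := 𝓘(ℝ, E)) (n := ∞)).mdifferentiable (by simp)

theorem mdifferentiable_mul_right (g : G) :
    MDifferentiable 𝓘(ℝ, E) 𝓘(ℝ, E) (fun x : G ↦ x * g) :=
  (contMDiff_mul_right (I := 𝓘(ℝ, E)) (n := ∞)).mdifferentiable (by simp)

theorem mdifferentiable_conj (g : G) :
    MDifferentiable 𝓘(ℝ, E) 𝓘(ℝ, E) (fun x : G ↦ g * x * g⁻¹) :=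
  (mdifferentiable_mul_right g⁻¹).comp (mdifferentiable_mul_left g)

theorem hasMFDerivAt_conj (g : G) :
    HasMFDerivAt 𝓘(ℝ, E) 𝓘(ℝ, E) (fun x : G ↦ g * x * g⁻¹) 1 (Ad 𝓘(ℝ, E) g : E →L[ℝ] E) :=
  (mdifferentiable_conj g 1).hasMFDerivAt

/-- The chain rule for `f ∘ (x ↦ g x g⁻¹)` at `1`, stated so that the derivative of `f` is taken at
`1` rather than at `g * 1 * g⁻¹`. -/
theorem hasMFDerivAt_comp_conj {E' : Type*} [NormedAddCommGroup E'] [NormedSpace ℝ E']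
    {M : Type*} [TopologicalSpace M] [ChartedSpace E' M] {f : G → M}
    (hf : MDifferentiableAt 𝓘(ℝ, E) 𝓘(ℝ, E') f 1) (g : G) :
    HasMFDerivAt 𝓘(ℝ, E) 𝓘(ℝ, E') (fun x ↦ f (g * x * g⁻¹)) 1
      ((mfderiv 𝓘(ℝ, E) 𝓘(ℝ, E') f 1 : E →L[ℝ] E').comp (Ad 𝓘(ℝ, E) g : E →L[ℝ] E)) := by
  have h1 : (1 : G) = g * 1 * g⁻¹ := by simp
  have hf' : HasMFDerivAt 𝓘(ℝ, E) 𝓘(ℝ, E') f (g * 1 * g⁻¹)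
      (mfderiv 𝓘(ℝ, E) 𝓘(ℝ, E') f 1 : E →L[ℝ] E') := by
    have := hf.hasMFDerivAt
    -- The derivative is generalized so that rewriting `1` does not touch its base point.
    revert this
    generalize (mfderiv 𝓘(ℝ, E) 𝓘(ℝ, E') f 1 : E →L[ℝ] E') = T
    intro this
    rwa [← h1]
  exact HasMFDerivAt.comp (1 : G) hf' (hasMFDerivAt_conj g)

theorem Ad_mul (g h : G) (X : GroupLieAlgebra 𝓘(ℝ, E) G) :
    Ad 𝓘(ℝ, E) (g * h) X = Ad 𝓘(ℝ, E) g (Ad 𝓘(ℝ, E) h X) := by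
  have h1 := hasMFDerivAt_comp_conj (mdifferentiable_conj (E := E) g 1) h
  have h2 := hasMFDerivAt_conj (E := E) (g * h)
  have : (fun x : G ↦ g * (h * x * h⁻¹) * g⁻¹) = fun x ↦ g * h * x * (g * h)⁻¹ := by
    ext x; group
  rw [this] at h1
  exact congrArg (fun T : E →L[ℝ] E ↦ T X) (hasMFDerivAt_unique h2 h1)

theorem Ad_one (X : GroupLieAlgebra 𝓘(ℝ, E) G) : Ad 𝓘(ℝ, E) (1 : G) X = X := by
  have h2 := hasMFDerivAt_conj (E := E) (1 : G)
  have : (fun x : G ↦ 1 * x * 1⁻¹) = id := by ext x; simp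
  rw [this] at h2
  exact congrArg (fun T : E →L[ℝ] E ↦ T X) (hasMFDerivAt_unique h2 (hasMFDerivAt_id 1))

variable (E) in
/-- The adjoint action `Ad g`, read as an endomorphism of the model space `E`. -/
def AdModel (g : G) : E →L[ℝ] E := Ad 𝓘(ℝ, E) g

theorem contMDiffAt_AdModel :
    ContMDiffAt 𝓘(ℝ, E) 𝓘(ℝ, E →L[ℝ] E) ∞ (AdModel E : G → E →L[ℝ] E) 1 := by
  have hf : ContMDiff (𝓘(ℝ, E).prod 𝓘(ℝ, E)) 𝓘(ℝ, E) ∞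
      (Function.uncurry fun (g x : G) ↦ g * x * g⁻¹) :=
    ((contMDiff_fst (n := ∞) (I := 𝓘(ℝ, E)) (J := 𝓘(ℝ, E))).mul contMDiff_snd).mul
      contMDiff_fst.inv
  have : ContMDiffAt 𝓘(ℝ, E) 𝓘(ℝ, E →L[ℝ] E) ∞ (inTangentCoordinates 𝓘(ℝ, E) 𝓘(ℝ, E)
      (fun _ : G ↦ (1 : G)) (fun g : G ↦ g * 1 * g⁻¹) (AdModel E) 1) 1 :=
    ContMDiffAt.mfderiv (x₀ := (1 : G)) (fun (g x : G) ↦ g * x * g⁻¹) (fun _ ↦ 1)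
      hf.contMDiffAt contMDiffAt_const (m := ∞) (by simp)
  refine this.congr_of_eventuallyEq (Filter.Eventually.of_forall fun g ↦ ?_)
  -- Source and target base points are constantly `1`, so the coordinate changes are trivial.
  have h1 : (fun g : G ↦ g * 1 * g⁻¹) = fun _ ↦ 1 := by ext; simp
  rw [h1, inTangentCoordinates_eq (x₀ := (1 : G)) (x := g) _ _ _ (mem_chart_source _ _)
    (mem_chart_source _ _)]
  ext v
  simp only [ContinuousLinearMap.comp_apply]
  rw [VectorBundleCore.coordChange_self, VectorBundleCore.coordChange_self]
  all_goals exact mem_chart_source _ _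

theorem mdifferentiableAt_AdModel_apply (X : E) :
    MDifferentiableAt 𝓘(ℝ, E) 𝓘(ℝ, E) (fun g : G ↦ AdModel E g X) 1 :=
  (contMDiffAt_AdModel.clm_apply (contMDiffAt_const (c := X))).mdifferentiableAt (by simp)

theorem contDiffAt_chartMul {x y : E} (hx : x ∈ (extChartAt 𝓘(ℝ, E) (1 : G)).target)
    (hy : y ∈ (extChartAt 𝓘(ℝ, E) (1 : G)).target)
    (hxy : (extChartAt 𝓘(ℝ, E) (1 : G)).symm x * (extChartAt 𝓘(ℝ, E) (1 : G)).symm y ∈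
      (chartAt E (1 : G)).source) :
    ContDiffAt ℝ ∞ (chartMul E G) (x, y) := by
  rw [← contMDiffAt_iff_contDiffAt]
  have h (z : E) (hz : z ∈ (extChartAt 𝓘(ℝ, E) (1 : G)).target) :
      ContMDiffAt 𝓘(ℝ, E) 𝓘(ℝ, E) ∞ (extChartAt 𝓘(ℝ, E) (1 : G)).symm z :=
    (contMDiffOn_extChartAt_symm (n := ∞) (1 : G)).contMDiffAt
      (extChartAt_target_mem_nhds' hz)
  have h3 := contMDiffAt_extChartAt' (I := 𝓘(ℝ, E)) (n := ∞) hxy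
  have h1 := (h x hx).comp (x, y) (contMDiffAt_fst (J := 𝓘(ℝ, E)) (n := ∞) (p := (x, y)))
  have h2 := (h y hy).comp (x, y) (contMDiffAt_snd (I := 𝓘(ℝ, E)) (n := ∞) (p := (x, y)))
  have := h3.comp (x, y) (h1.mul h2)
  rw [← modelWithCornersSelf_prod, chartedSpaceSelf_prod] at this
  exact this

theorem fderiv_chartMul_right {x : E} (hx : x ∈ (extChartAt 𝓘(ℝ, E) (1 : G)).target) (X : E) :
    fderiv ℝ (chartMul E G) (x, chartOne E G) (0, X) =
      derivOne (fun y : G ↦ extChartAt 𝓘(ℝ, E) (1 : G)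
        ((extChartAt 𝓘(ℝ, E) (1 : G)).symm x * y)) X := by
  have hs := (extChartAt 𝓘(ℝ, E) (1 : G)).map_target hx
  rw [extChartAt_source] at hs
  have h1 : ContDiffAt ℝ ∞ (chartMul E G) (x, chartOne E G) :=
    contDiffAt_chartMul hx (mem_extChartAt_target 1)
      (by rw [extChartAt_symm_chartOne, mul_one]; exact hs)
  have h2 : HasFDerivAt (fun y ↦ chartMul E G (x, y)) _ (chartOne E G) :=
    HasFDerivAt.comp (f := fun y ↦ (x, y)) (chartOne E G)
      (h1.differentiableAt (by simp)).hasFDerivAt (hasFDerivAt_prodMk_right x (chartOne E G))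
  have h3 : MDifferentiableAt 𝓘(ℝ, E) 𝓘(ℝ, E) (fun y : G ↦ extChartAt 𝓘(ℝ, E) (1 : G)
        ((extChartAt 𝓘(ℝ, E) (1 : G)).symm x * y)) 1 :=
    MDifferentiableAt.comp (1 : G) (mdifferentiableAt_extChartAt (by rw [mul_one]; exact hs))
      (mdifferentiable_mul_left _ 1)
  have h4 := hasFDerivAt_comp_extChartAt_symm h3
  rw [← h2.unique h4]
  simp

theorem fderiv_chartMul_left {x : E} (hx : x ∈ (extChartAt 𝓘(ℝ, E) (1 : G)).target) (X : E) :
    fderiv ℝ (chartMul E G) (chartOne E G, x) (X, 0) =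
      derivOne (fun y : G ↦ extChartAt 𝓘(ℝ, E) (1 : G)
        (y * (extChartAt 𝓘(ℝ, E) (1 : G)).symm x)) X := by
  have hs := (extChartAt 𝓘(ℝ, E) (1 : G)).map_target hx
  rw [extChartAt_source] at hs
  have h1 : ContDiffAt ℝ ∞ (chartMul E G) (chartOne E G, x) :=
    contDiffAt_chartMul (mem_extChartAt_target 1) hx
      (by rw [extChartAt_symm_chartOne, one_mul]; exact hs)
  have h2 : HasFDerivAt (fun y ↦ chartMul E G (y, x)) _ (chartOne E G) :=
    HasFDerivAt.comp (f := fun y ↦ (y, x)) (chartOne E G)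
      (h1.differentiableAt (by simp)).hasFDerivAt (hasFDerivAt_prodMk_left (chartOne E G) x)
  have h3 : MDifferentiableAt 𝓘(ℝ, E) 𝓘(ℝ, E) (fun y : G ↦ extChartAt 𝓘(ℝ, E) (1 : G)
        (y * (extChartAt 𝓘(ℝ, E) (1 : G)).symm x)) 1 :=
    MDifferentiableAt.comp (1 : G) (mdifferentiableAt_extChartAt (by rw [one_mul]; exact hs))
      (mdifferentiable_mul_right _ 1)
  have h4 := hasFDerivAt_comp_extChartAt_symm h3
  rw [← h2.unique h4]
  simp

/-- The left-invariant vector field of `X`, read in the chart at `1`. -/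
theorem mpullbackWithin_mulInvariantVectorField {x : E}
    (hx : x ∈ (extChartAt 𝓘(ℝ, E) (1 : G)).target) (X : GroupLieAlgebra 𝓘(ℝ, E) G) :
    VectorField.mpullbackWithin 𝓘(ℝ, E) 𝓘(ℝ, E) (extChartAt 𝓘(ℝ, E) (1 : G)).symm
      (mulInvariantVectorField X) (Set.range 𝓘(ℝ, E)) x =
      fderiv ℝ (chartMul E G) (x, chartOne E G) (0, (X : E)) := by
  refine Eq.trans ?_ (fderiv_chartMul_right hx X).symm
  have hs := (extChartAt 𝓘(ℝ, E) (1 : G)).map_target hx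
  have hs' := hs
  rw [extChartAt_source] at hs'
  have A1 := mfderiv_extChartAt_comp_mfderivWithin_extChartAt_symm (I := 𝓘(ℝ, E)) hx
  have A2 := mfderivWithin_extChartAt_symm_comp_mfderiv_extChartAt (I := 𝓘(ℝ, E)) hx
  rw [VectorField.mpullbackWithin_apply, ContinuousLinearMap.inverse_eq A2 A1]
  generalize (extChartAt 𝓘(ℝ, E) (1 : G)).symm x = g at *
  have h1 : HasMFDerivAt 𝓘(ℝ, E) 𝓘(ℝ, E) (extChartAt 𝓘(ℝ, E) (1 : G)) (g * 1)
      (mfderiv 𝓘(ℝ, E) 𝓘(ℝ, E) (extChartAt 𝓘(ℝ, E) (1 : G)) g : E →L[ℝ] E) := by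
    have := (mdifferentiableAt_extChartAt (I := 𝓘(ℝ, E)) hs').hasMFDerivAt
    -- The derivative is generalized so that rewriting `g * 1` does not touch its base point.
    revert this
    generalize (mfderiv 𝓘(ℝ, E) 𝓘(ℝ, E) (extChartAt 𝓘(ℝ, E) (1 : G)) g : E →L[ℝ] E) = T
    intro this
    rwa [mul_one]
  have h2 := HasMFDerivAt.comp (1 : G) h1 (mdifferentiable_mul_left g 1).hasMFDerivAt
  exact (congrArg (fun T : E →L[ℝ] E ↦ T X) h2.mfderiv).symm

/-- The relation `d(L_g) X = d(R_g) (Ad g X)`, read in the chart at `1`. -/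
theorem fderiv_chartMul_Ad {x : E} (hx : x ∈ (extChartAt 𝓘(ℝ, E) (1 : G)).target) (X : E) :
    fderiv ℝ (chartMul E G) (x, chartOne E G) (0, X) =
      fderiv ℝ (chartMul E G) (chartOne E G, x)
        (AdModel E ((extChartAt 𝓘(ℝ, E) (1 : G)).symm x) X, 0) := by
  rw [fderiv_chartMul_right hx, fderiv_chartMul_left hx]
  have hs := (extChartAt 𝓘(ℝ, E) (1 : G)).map_target hx
  rw [extChartAt_source] at hs
  generalize (extChartAt 𝓘(ℝ, E) (1 : G)).symm x = g at *
  have h3 : MDifferentiableAt 𝓘(ℝ, E) 𝓘(ℝ, E) (fun y : G ↦ extChartAt 𝓘(ℝ, E) (1 : G)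
        (y * g)) 1 :=
    MDifferentiableAt.comp (1 : G) (mdifferentiableAt_extChartAt (by rw [one_mul]; exact hs))
      (mdifferentiable_mul_right _ 1)
  have h4 : derivOne (fun y : G ↦ extChartAt 𝓘(ℝ, E) (1 : G) (g * y * g⁻¹ * g)) =
      (derivOne (fun y : G ↦ extChartAt 𝓘(ℝ, E) (1 : G) (y * g))).comp (AdModel E g) :=
    (hasMFDerivAt_comp_conj h3 g).mfderiv
  simp only [inv_mul_cancel_right] at h4
  rw [h4]
  rfl

theorem AdModel_mul_apply (g h : G) (X : E) :
    AdModel E (g * h) X = AdModel E g (AdModel E h X) := Ad_mul g h X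

theorem AdModel_one_apply (X : E) : AdModel E (1 : G) X = X := Ad_one X

variable (G) in
/-- The Lie bracket of `𝔤`, read on the model space. -/
def lieModel (Z X : E) : E :=
  Bracket.bracket (L := GroupLieAlgebra 𝓘(ℝ, E) G) (M := GroupLieAlgebra 𝓘(ℝ, E) G) Z X

theorem lieModel_eq_fderiv_chartMul (Z X : E) :
    lieModel G Z X =
      fderiv ℝ (fun x ↦ fderiv ℝ (chartMul E G) (x, chartOne E G) (0, X)) (chartOne E G) Z -
      fderiv ℝ (fun x ↦ fderiv ℝ (chartMul E G) (x, chartOne E G) (0, Z)) (chartOne E G) X := by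
  let V (Y : E) : E → E := VectorField.mpullbackWithin 𝓘(ℝ, E) 𝓘(ℝ, E)
    (extChartAt 𝓘(ℝ, E) (1 : G)).symm
    (mulInvariantVectorField (Y : GroupLieAlgebra 𝓘(ℝ, E) G)) (Set.range 𝓘(ℝ, E))
  have hV (Y : E) : V Y =ᶠ[nhds (chartOne E G)]
      fun x ↦ fderiv ℝ (chartMul E G) (x, chartOne E G) (0, Y) := by
    filter_upwards [eventually_mem_target] with x hx
    exact mpullbackWithin_mulInvariantVectorField hx Y
  have hone (Y : E) : fderiv ℝ (chartMul E G) (chartOne E G, chartOne E G) (0, Y) = Y := by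
    rw [fderiv_chartMul_right (show chartOne E G ∈ _ from mem_extChartAt_target 1),
      extChartAt_symm_chartOne]
    simp only [one_mul]
    exact congrArg (fun T : E →L[ℝ] E ↦ T Y) mfderiv_extChartAt_self
  have hid : (mfderiv 𝓘(ℝ, E) 𝓘(ℝ, E) (extChartAt 𝓘(ℝ, E) (1 : G)) 1).inverse =
    ContinuousLinearMap.id ℝ E := by
    rw [mfderiv_extChartAt_self]; exact ContinuousLinearMap.inverse_id
  have hset : (extChartAt 𝓘(ℝ, E) (1 : G)).symm ⁻¹' Set.univ ∩ Set.range 𝓘(ℝ, E) = Set.univ := by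
    simp
  have h1 : lieModel G Z X = VectorField.lieBracketWithin ℝ (V Z) (V X)
      ((extChartAt 𝓘(ℝ, E) (1 : G)).symm ⁻¹' Set.univ ∩ Set.range 𝓘(ℝ, E)) (chartOne E G) :=
    congrArg (fun T : E →L[ℝ] E ↦ T (VectorField.lieBracketWithin ℝ (V Z) (V X)
      ((extChartAt 𝓘(ℝ, E) (1 : G)).symm ⁻¹' Set.univ ∩ Set.range 𝓘(ℝ, E)) (chartOne E G))) hid
  rw [h1, hset, VectorField.lieBracketWithin_univ,
    Filter.EventuallyEq.lieBracket_vectorField_eq (hV Z) (hV X), VectorField.lieBracket]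
  simp only [hone]

/-- The derivative of `g ↦ Ad g X` at `1` in the direction `Z` is `⁅Z, X⁆`. -/
theorem derivOne_AdModel_apply (X Z : E) :
    derivOne (fun g : G ↦ AdModel E g X) Z = lieModel G Z X := by
  have h := hasFDerivAt_comp_extChartAt_symm (mdifferentiableAt_AdModel_apply (G := G) X)
  rw [lieModel_eq_fderiv_chartMul, ← fderiv_eq_sub_of_fderiv_mul _ _ h.differentiableAt _ _,
    h.fderiv]
  · refine (contDiffAt_chartMul (mem_extChartAt_target 1) (mem_extChartAt_target 1) ?_).of_le
      (by norm_cast)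
    rw [← chartOne, extChartAt_symm_chartOne, mul_one]
    exact mem_chart_source _ _
  · filter_upwards [eventually_mem_target] with x hx
    rw [chartMul, extChartAt_symm_chartOne, mul_one]
    exact (extChartAt 𝓘(ℝ, E) (1 : G)).right_inv hx
  · rw [extChartAt_symm_chartOne]
    exact Ad_one X
  · filter_upwards [eventually_mem_target] with x hx
    exact fderiv_chartMul_Ad hx X

/-- `Ad g` is a Lie algebra endomorphism: differentiate `Ad g (Ad h X) = Ad (g h g⁻¹) (Ad g X)` with
respect to `h` at `1`. -/
theorem AdModel_lieModel (g : G) (Z X : E) :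
    AdModel E g (lieModel G Z X) = lieModel G (AdModel E g Z) (AdModel E g X) := by
  have h1 := (hasMFDerivAt_clm_comp (AdModel E g)
    (mdifferentiableAt_AdModel_apply (G := G) X)).mfderiv
  have h2 := (hasMFDerivAt_comp_conj
    (mdifferentiableAt_AdModel_apply (G := G) (AdModel E g X)) g).mfderiv
  have h3 : (fun h : G ↦ AdModel E (g * h * g⁻¹) (AdModel E g X)) =
      fun h ↦ AdModel E g (AdModel E h X) := by
    ext h
    rw [← AdModel_mul_apply, ← AdModel_mul_apply, inv_mul_cancel_right]
  rw [h3] at h2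
  have := congrArg (fun T : E →L[ℝ] E ↦ T Z) (h1.symm.trans h2)
  rw [← derivOne_AdModel_apply, ← derivOne_AdModel_apply]
  exact this

/-- A functional that kills all brackets is invariant under `Ad g` for `g` in the identity
component. -/
theorem AdModel_apply_of_mem_idComponent {ℓ : E →L[ℝ] ℝ} (hℓ : ∀ Z X, ℓ (lieModel G Z X) = 0)
    {g : G} (hg : g ∈ idComponent E G) (X : E) : ℓ (AdModel E g X) = ℓ X := by
  have hd (g : G) : HasMFDerivAt 𝓘(ℝ, E) 𝓘(ℝ, ℝ) (fun g : G ↦ ℓ (AdModel E g X)) g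
      (0 : E →L[ℝ] ℝ) := by
    have h1 := hasMFDerivAt_clm_comp (ℓ.comp (AdModel E g))
      (mdifferentiableAt_AdModel_apply (G := G) X)
    -- By translation it is enough to differentiate `h ↦ ℓ (Ad g (Ad h X))` at `1`, where the
    -- derivative is `Z ↦ ℓ ⁅Ad g Z, Ad g X⁆ = 0`.
    have h0 : (ℓ.comp (AdModel E g)).comp (derivOne fun g : G ↦ AdModel E g X) = 0 := by
      ext Z
      simp [derivOne_AdModel_apply, AdModel_lieModel, hℓ]
    rw [h0] at h1
    have h1' : HasMFDerivAt 𝓘(ℝ, E) 𝓘(ℝ, ℝ)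
        (fun h : G ↦ (ℓ.comp (AdModel E g)) (AdModel E h X)) (g⁻¹ * g) (0 : E →L[ℝ] ℝ) := by
      rwa [inv_mul_cancel]
    have h2 := HasMFDerivAt.comp g h1' (mdifferentiable_mul_left g⁻¹ g).hasMFDerivAt
    have h3 : ((fun h : G ↦ (ℓ.comp (AdModel E g)) (AdModel E h X)) ∘ fun h ↦ g⁻¹ * h) =
        fun g : G ↦ ℓ (AdModel E g X) := by
      ext h
      simp [← AdModel_mul_apply]
    rw [h3] at h2
    exact h2.congr_mfderiv (ContinuousLinearMap.zero_comp _)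
  have : IsManifold 𝓘(ℝ, E) 1 G := IsManifold.of_le (n := ∞) (by simp)
  have := (isLocallyConstant_of_hasMFDerivAt_zero hd).apply_eq_of_isPreconnected
    (isPreconnected_connectedComponent (x := (1 : G))) hg mem_connectedComponent
  simpa only [AdModel_one_apply] using this

variable [CompleteSpace E]

/-- An `Ad(G₀)`-invariant alternating form on `𝔤` vanishes when one argument is a bracket. -/
theorem map_lieModel_eq_zero_of_invariant {β : E →L[ℝ] E →L[ℝ] ℝ} (hβ : ∀ X, β X X = 0)
    (hinv : ∀ g ∈ idComponent E G, ∀ X Y, β (AdModel E g X) (AdModel E g Y) = β X Y) (X Y Z : E) :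
    β (lieModel G X Y) Z = 0 := by
  have hneg (X Y : E) : β X Y = - β Y X := by
    have := hβ (X + Y)
    simp only [map_add, add_apply, hβ] at this
    linarith
  have hlie (X Y : E) : lieModel G X Y = - lieModel G Y X :=
    (lie_skew (L := GroupLieAlgebra 𝓘(ℝ, E) G) X Y).symm
  -- The derivative at `1` of the constant function `g ↦ β (Ad g X) (Ad g Y)` on `G₀`.
  have hd (Z X Y : E) : β (lieModel G Z X) Y + β X (lieModel G Z Y) = 0 := by
    have hX := hasFDerivAt_comp_extChartAt_symm (mdifferentiableAt_AdModel_apply (G := G) X)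
    have hY := hasFDerivAt_comp_extChartAt_symm (mdifferentiableAt_AdModel_apply (G := G) Y)
    have h1 := (HasFDerivAt.comp (chartOne E G) β.hasFDerivAt hX).clm_apply hY
    have hev : ∀ᶠ x in nhds (chartOne E G),
        (extChartAt 𝓘(ℝ, E) (1 : G)).symm x ∈ (idComponent E G : Set G) := by
      refine (continuousAt_extChartAt_symm (I := 𝓘(ℝ, E)) (1 : G)).eventually_mem ?_
      rw [extChartAt_to_inv]
      exact (isOpen_idComponent E G).mem_nhds (one_mem _)
    have h2 := (hasFDerivAt_const (𝕜 := ℝ) (β X Y) (chartOne E G)).congr_of_eventuallyEq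
      (f₁ := fun x ↦ β (AdModel E ((extChartAt 𝓘(ℝ, E) (1 : G)).symm x) X)
        (AdModel E ((extChartAt 𝓘(ℝ, E) (1 : G)).symm x) Y))
      (by filter_upwards [hev] with x hx using hinv _ hx X Y)
    simp only [Function.comp_apply, extChartAt_symm_chartOne, AdModel_one_apply] at h1
    have := congrArg (fun T : E →L[ℝ] ℝ ↦ T Z) (h1.unique h2)
    simp [derivOne_AdModel_apply] at this
    linarith
  -- `β (⁅Z, X⁆, Y)` is symmetric in `X, Y` and antisymmetric in `Z, X`.
  have hs (Z X Y : E) : β (lieModel G Z X) Y = β (lieModel G Z Y) X := by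
    linarith [hd Z X Y, hneg X (lieModel G Z Y)]
  have ha (Z X Y : E) : β (lieModel G Z X) Y = - β (lieModel G X Z) Y := by
    rw [hlie Z X]; simp
  -- Alternating the two symmetries runs through all six permutations with total sign `-1`.
  linarith [ha X Y Z, hs Y X Z, ha Y Z X, hs Z Y X, ha Z X Y, hs X Z Y]

end Adjoint

/-! ### Left-invariant 2-forms -/

section LeftInvariant
variable {E : Type*} [NormedAddCommGroup E] [NormedSpace ℝ E]
  {G : Type*} [TopologicalSpace G] [ChartedSpace E G] [Group G] [LieGroup 𝓘(ℝ, E) ∞ G]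

/-- The derivative at `x` of left translation by `x⁻¹`: the left Maurer–Cartan form. -/
def maurerCartan (x : G) : TangentSpace 𝓘(ℝ, E) x →L[ℝ] E :=
  mfderiv 𝓘(ℝ, E) 𝓘(ℝ, E) (fun y : G ↦ x⁻¹ * y) x

theorem hasMFDerivAt_inv_mul (x : G) :
    HasMFDerivAt 𝓘(ℝ, E) 𝓘(ℝ, E) (fun y : G ↦ x⁻¹ * y) x (maurerCartan (E := E) x : E →L[ℝ] E) :=
  (mdifferentiable_mul_left x⁻¹ x).hasMFDerivAt

theorem maurerCartan_one (v : TangentSpace 𝓘(ℝ, E) (1 : G)) : maurerCartan (1 : G) v = v := by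
  have h := hasMFDerivAt_inv_mul (E := E) (1 : G)
  have h1 : (fun y : G ↦ (1 : G)⁻¹ * y) = id := by ext; simp
  rw [h1] at h
  exact congrArg (fun T : E →L[ℝ] E ↦ T v) (hasMFDerivAt_unique h (hasMFDerivAt_id 1))

theorem maurerCartan_mul_left (g x : G) (v : TangentSpace 𝓘(ℝ, E) x) :
    maurerCartan (g * x) (mfderiv 𝓘(ℝ, E) 𝓘(ℝ, E) (fun y : G ↦ g * y) x v) =
      maurerCartan x v := by
  have h := HasMFDerivAt.comp x (hasMFDerivAt_inv_mul (E := E) (g * x))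
    (mdifferentiable_mul_left g x).hasMFDerivAt
  have h1 : (fun y : G ↦ (g * x)⁻¹ * y) ∘ (fun y ↦ g * y) = fun y ↦ x⁻¹ * y := by
    ext; simp [mul_assoc]
  rw [h1] at h
  exact congrArg (fun T : E →L[ℝ] E ↦ T v) (hasMFDerivAt_unique h (hasMFDerivAt_inv_mul x))

theorem maurerCartan_mul_right (g x : G) (v : TangentSpace 𝓘(ℝ, E) x) :
    maurerCartan (x * g) (mfderiv 𝓘(ℝ, E) 𝓘(ℝ, E) (fun y : G ↦ y * g) x v) =
      AdModel E g⁻¹ (maurerCartan x v) := by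
  have h := HasMFDerivAt.comp x (hasMFDerivAt_inv_mul (E := E) (x * g))
    (mdifferentiable_mul_right g x).hasMFDerivAt
  have h' : HasMFDerivAt 𝓘(ℝ, E) 𝓘(ℝ, E) (fun y : G ↦ g⁻¹ * y * g⁻¹⁻¹) (x⁻¹ * x)
      (AdModel E g⁻¹) := by
    have := hasMFDerivAt_conj (E := E) g⁻¹
    rwa [inv_mul_cancel]
  have h2 := HasMFDerivAt.comp x h' (hasMFDerivAt_inv_mul x)
  have h1 : (fun y : G ↦ (x * g)⁻¹ * y) ∘ (fun y ↦ y * g) =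
      (fun y : G ↦ g⁻¹ * y * g⁻¹⁻¹) ∘ fun y ↦ x⁻¹ * y := by
    ext; simp [mul_assoc]
  rw [h1] at h
  exact congrArg (fun T : E →L[ℝ] E ↦ T v) (hasMFDerivAt_unique h h2)

/-- The left-invariant field of bilinear forms with value `β` at `1`. -/
def leftInvFun (β : E →L[ℝ] E →L[ℝ] ℝ) (x : G) :
    TangentSpace 𝓘(ℝ, E) x →L[ℝ] TangentSpace 𝓘(ℝ, E) x →L[ℝ] ℝ :=
  (ContinuousLinearMap.precomp ℝ (maurerCartan x)).comp (β.comp (maurerCartan x))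

variable (E) in
/-- Smoothness of the Maurer–Cartan form, read in the trivialization of the tangent bundle at
`x₀`. -/
theorem contMDiffAt_maurerCartan (x₀ : G) : ContMDiffAt 𝓘(ℝ, E) 𝓘(ℝ, E →L[ℝ] E) ∞
    (fun x : G ↦ (maurerCartan x : E →L[ℝ] E).comp
      ((trivializationAt E (TangentSpace 𝓘(ℝ, E)) x₀).symmL ℝ x : E →L[ℝ] E)) x₀ := by
  have hf : ContMDiff (𝓘(ℝ, E).prod 𝓘(ℝ, E)) 𝓘(ℝ, E) ∞
      (Function.uncurry fun (x y : G) ↦ x⁻¹ * y) :=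
    (contMDiff_fst (n := ∞) (I := 𝓘(ℝ, E)) (J := 𝓘(ℝ, E))).inv.mul contMDiff_snd
  have : ContMDiffAt 𝓘(ℝ, E) 𝓘(ℝ, E →L[ℝ] E) ∞ (inTangentCoordinates 𝓘(ℝ, E) 𝓘(ℝ, E)
      (fun x : G ↦ x) (fun x : G ↦ x⁻¹ * x) (fun x ↦ (maurerCartan x : E →L[ℝ] E)) x₀) x₀ :=
    ContMDiffAt.mfderiv (x₀ := x₀) (fun (x y : G) ↦ x⁻¹ * y) (fun x ↦ x)
      hf.contMDiffAt contMDiffAt_id (m := ∞) (by simp)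
  have h1 : (fun x : G ↦ x⁻¹ * x) = fun _ ↦ 1 := by ext; simp
  rw [h1] at this
  refine this.congr_of_eventuallyEq (Filter.Eventually.of_forall fun x ↦ ?_)
  -- The target base point is constantly `1`, where the trivialization is the identity.
  have h2 : ((trivializationAt E (TangentSpace 𝓘(ℝ, E)) (1 : G)).continuousLinearMapAt ℝ 1 :
      E →L[ℝ] E) = ContinuousLinearMap.id ℝ E :=
    (TangentBundle.continuousLinearMapAt_trivializationAt (mem_chart_source E (1 : G))).trans
      mfderiv_extChartAt_self
  exact (congrArg (fun T : E →L[ℝ] E ↦ T.comp ((maurerCartan x : E →L[ℝ] E).comp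
      ((trivializationAt E (TangentSpace 𝓘(ℝ, E)) x₀).symmL ℝ x : E →L[ℝ] E))) h2).symm

set_option synthInstance.maxHeartbeats 400000 in
theorem contMDiff_leftInvFun (β : E →L[ℝ] E →L[ℝ] ℝ) :
    ContMDiff 𝓘(ℝ, E) (𝓘(ℝ, E).prod 𝓘(ℝ, E →L[ℝ] E →L[ℝ] ℝ)) ∞
      (fun x ↦ Bundle.TotalSpace.mk' (E →L[ℝ] E →L[ℝ] ℝ)
        (E := fun x : G ↦ TangentSpace 𝓘(ℝ, E) x →L[ℝ] TangentSpace 𝓘(ℝ, E) x →L[ℝ] ℝ)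
        x (leftInvFun β x)) := by
  intro x₀
  rw [contMDiffAt_hom_bundle]
  refine ⟨contMDiffAt_id, ?_⟩
  have hA := contMDiffAt_maurerCartan E x₀
  let T : (E →L[ℝ] E) →L[ℝ] ((E →L[ℝ] ℝ) →L[ℝ] (E →L[ℝ] ℝ)) :=
    (ContinuousLinearMap.compL ℝ E E ℝ).flip
  have hT : ContMDiff 𝓘(ℝ, E →L[ℝ] E) 𝓘(ℝ, (E →L[ℝ] ℝ) →L[ℝ] (E →L[ℝ] ℝ)) ∞ T := by
    rw [contMDiff_iff_contDiff]
    exact ContinuousLinearMap.contDiff (𝕜 := ℝ) (E := E →L[ℝ] E)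
      (F := (E →L[ℝ] ℝ) →L[ℝ] (E →L[ℝ] ℝ)) T
  have hB := ContMDiffAt.comp x₀ hT.contMDiffAt hA
  have hβ : ContMDiffAt 𝓘(ℝ, E) 𝓘(ℝ, E →L[ℝ] E →L[ℝ] ℝ) ∞ (fun _ : G ↦ β) x₀ := contMDiffAt_const
  have key := hB.clm_comp (hβ.clm_comp hA)
  refine key.congr_of_eventuallyEq ?_
  have h1 : ∀ᶠ x in nhds x₀, x ∈ (trivializationAt E (TangentSpace 𝓘(ℝ, E)) x₀).baseSet :=
    (trivializationAt E (TangentSpace 𝓘(ℝ, E)) x₀).open_baseSet.mem_nhds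
      (FiberBundle.mem_baseSet_trivializationAt' x₀)
  filter_upwards [h1] with x hx
  ext v w
  rw [inCoordinates_apply_eq₂ hx hx (Set.mem_univ _)]
  rw [← Bundle.Trivialization.symmL_apply (R := ℝ) _ hx,
    ← Bundle.Trivialization.symmL_apply (R := ℝ) _ hx,
    Bundle.Trivialization.coe_linearMapAt_of_mem _ (Set.mem_univ _)]
  rfl

/-- The left-invariant 2-form on `G` with value the alternating form `β` at `1`. -/
def leftInvForm (β : E →L[ℝ] E →L[ℝ] ℝ) (hβ : ∀ X, β X X = 0) : TwoForm 𝓘(ℝ, E) G :=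
  ⟨⟨leftInvFun β, contMDiff_leftInvFun β⟩, fun _ _ ↦ hβ _⟩

theorem twoForm_ext {M : Type*} [TopologicalSpace M] [ChartedSpace E M] [IsManifold 𝓘(ℝ, E) ∞ M]
    {η θ : TwoForm 𝓘(ℝ, E) M}
    (h : ∀ (x : M) (v w : TangentSpace 𝓘(ℝ, E) x), η.1 x v w = θ.1 x v w) : η = θ := by
  refine Subtype.ext (ContMDiffSection.ext fun x ↦ ?_)
  ext v w
  exact h x v w

theorem pullback_smoothLeftMul_leftInvForm (β : E →L[ℝ] E →L[ℝ] ℝ) (hβ : ∀ X, β X X = 0) (g : G) :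
    pullback (smoothLeftMul 𝓘(ℝ, E) g) (leftInvForm β hβ) = leftInvForm β hβ :=
  twoForm_ext fun x v w ↦ congrArg₂ (fun v w ↦ β v w) (maurerCartan_mul_left g x v)
    (maurerCartan_mul_left g x w)

/-- Right translation by `g` acts on left-invariant forms through `Ad g⁻¹`. -/
theorem pullback_smoothRightMul_leftInvForm_apply (β : E →L[ℝ] E →L[ℝ] ℝ) (hβ : ∀ X, β X X = 0)
    (g x : G) (v w : TangentSpace 𝓘(ℝ, E) x) :
    (pullback (smoothRightMul 𝓘(ℝ, E) g) (leftInvForm β hβ)).1 x v w =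
      β (AdModel E g⁻¹ (maurerCartan x v)) (AdModel E g⁻¹ (maurerCartan x w)) :=
  congrArg₂ (fun v w ↦ β v w) (maurerCartan_mul_right g x v) (maurerCartan_mul_right g x w)

/-- The value of a 2-form at the identity, read on the model space. -/
def formAtOne (η : TwoForm 𝓘(ℝ, E) G) : E →L[ℝ] E →L[ℝ] ℝ := η.1 1

theorem formAtOne_self (η : TwoForm 𝓘(ℝ, E) G) (X : E) : formAtOne η X X = 0 := η.2 1 X

theorem formAtOne_leftInvForm (β : E →L[ℝ] E →L[ℝ] ℝ) (hβ : ∀ X, β X X = 0) :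
    formAtOne (leftInvForm β hβ : TwoForm 𝓘(ℝ, E) G) = β := by
  ext X Y
  exact congrArg₂ (fun v w ↦ β v w) (maurerCartan_one X) (maurerCartan_one Y)

/-- A left-invariant 2-form is determined by its value at `1`. -/
theorem eq_leftInvForm {η : TwoForm 𝓘(ℝ, E) G}
    (hη : ∀ g : G, pullback (smoothLeftMul 𝓘(ℝ, E) g) η = η) :
    η = leftInvForm (formAtOne η) (formAtOne_self η) := by
  refine twoForm_ext fun x v w ↦ ?_
  have h1 (y : G) (hy : y = 1) (v w : E) :
    (η.1 y : E →L[ℝ] E →L[ℝ] ℝ) v w = formAtOne η v w := by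
    subst hy; rfl
  exact (congrArg (fun θ : TwoForm 𝓘(ℝ, E) G ↦ θ.1 x v w) (hη x⁻¹)).symm.trans
    (h1 (x⁻¹ * x) (inv_mul_cancel x) _ _)

/-- A left-invariant 2-form is bi-invariant iff its value at `1` is `Ad`-invariant. -/
theorem leftInvForm_mem_iff (β : E →L[ℝ] E →L[ℝ] ℝ) (hβ : ∀ X, β X X = 0) :
    leftInvForm β hβ ∈ BiInvariantTwoForm 𝓘(ℝ, E) G ↔
      ∀ (g : G) (X Y : E), β (AdModel E g X) (AdModel E g Y) = β X Y := by
  constructor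
  · intro h g X Y
    have h1 : formAtOne (pullback (smoothRightMul 𝓘(ℝ, E) g⁻¹) (leftInvForm β hβ)) X Y =
        β (AdModel E g⁻¹⁻¹ X) (AdModel E g⁻¹⁻¹ Y) :=
      (pullback_smoothRightMul_leftInvForm_apply β hβ g⁻¹ 1 X Y).trans
        (congrArg₂ (fun v w ↦ β (AdModel E g⁻¹⁻¹ v) (AdModel E g⁻¹⁻¹ w)) (maurerCartan_one X)
          (maurerCartan_one Y))
    rw [(h g⁻¹).2, inv_inv, formAtOne_leftInvForm] at h1
    exact h1.symm
  · intro h g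
    exact ⟨pullback_smoothLeftMul_leftInvForm β hβ g, twoForm_ext fun x v w ↦
      (pullback_smoothRightMul_leftInvForm_apply β hβ g x v w).trans (h _ _ _)⟩

/-- The value at `1` of a bi-invariant 2-form is `Ad`-invariant. -/
theorem formAtOne_AdModel {η : TwoForm 𝓘(ℝ, E) G} (hη : η ∈ BiInvariantTwoForm 𝓘(ℝ, E) G)
    (g : G) (X Y : E) :
    formAtOne η (AdModel E g X) (AdModel E g Y) = formAtOne η X Y := by
  have h := eq_leftInvForm fun g ↦ (hη g).1
  rw [h] at hη
  exact (leftInvForm_mem_iff _ _).1 hη g X Y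

theorem eq_of_formAtOne_eq {η θ : TwoForm 𝓘(ℝ, E) G} (hη : η ∈ BiInvariantTwoForm 𝓘(ℝ, E) G)
    (hθ : θ ∈ BiInvariantTwoForm 𝓘(ℝ, E) G) (h : formAtOne η = formAtOne θ) : η = θ := by
  rw [eq_leftInvForm fun g ↦ (hη g).1, eq_leftInvForm fun g ↦ (hθ g).1]
  simp only [h]

end LeftInvariant

/-! ### The inclusion of the identity component -/

section Inclusion
variable {E : Type*} [NormedAddCommGroup E] [NormedSpace ℝ E]
  {G : Type*} [TopologicalSpace G] [ChartedSpace E G] [Group G] [LieGroup 𝓘(ℝ, E) ∞ G]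

variable (E G) in
/-- The derivative at `1` of the inclusion `G₀ → G`, read on the model space. -/
def inclDeriv : E →L[ℝ] E := mfderiv 𝓘(ℝ, E) 𝓘(ℝ, E) (idComponentIncl E G) 1

theorem hasMFDerivAt_incl : HasMFDerivAt 𝓘(ℝ, E) 𝓘(ℝ, E) (Subtype.val : idComponent E G → G) 1
    (inclDeriv E G) :=
  ((idComponentIncl E G).contMDiff.mdifferentiableAt (by simp)).hasMFDerivAt

variable (E G) in
/-- The derivative at `1` of the inclusion of the open subgroup `G₀` is an isomorphism. -/
theorem exists_inclDeriv_inverse : ∃ R : E →L[ℝ] E,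
    R.comp (inclDeriv E G) = ContinuousLinearMap.id ℝ E ∧
    (inclDeriv E G).comp R = ContinuousLinearMap.id ℝ E := by
  classical
  -- A smooth retraction near `1` of the open subset `G₀`; its derivative is the inverse.
  let r : G → idComponent E G := fun g ↦ if h : g ∈ idComponent E G then ⟨g, h⟩ else 1
  have hr : ∀ g : idComponent E G, r g = g := fun g ↦ by simp [r]
  have hr' : ContMDiffAt 𝓘(ℝ, E) 𝓘(ℝ, E) ∞ r ((1 : idComponent E G) : G) := by
    refine (contMDiffAt_subtype_iff (U := idComponentOpens E G) (f := r)
      (x := ⟨1, one_mem (idComponent E G)⟩)).1 ?_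
    have : (fun g : idComponentOpens E G ↦ r g) = id := funext hr
    rw [this]
    exact contMDiffAt_id
  have hd := (hr'.mdifferentiableAt (by simp)).hasMFDerivAt
  refine ⟨(mfderiv 𝓘(ℝ, E) 𝓘(ℝ, E) r ((1 : idComponent E G) : G) : E →L[ℝ] E), ?_, ?_⟩
  · have h1 := HasMFDerivAt.comp (1 : idComponent E G) hd hasMFDerivAt_incl
    have : r ∘ (Subtype.val : idComponent E G → G) = id := funext hr
    rw [this] at h1
    exact hasMFDerivAt_unique h1 (hasMFDerivAt_id _)
  · have h0 : HasMFDerivAt 𝓘(ℝ, E) 𝓘(ℝ, E) (Subtype.val : idComponent E G → G)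
        (r ((1 : idComponent E G) : G)) (inclDeriv E G) := by
      rw [hr]; exact hasMFDerivAt_incl
    have h1 := HasMFDerivAt.comp ((1 : idComponent E G) : G) h0 hd
    have h2 : HasMFDerivAt 𝓘(ℝ, E) 𝓘(ℝ, E) ((Subtype.val : idComponent E G → G) ∘ r)
        ((1 : idComponent E G) : G) (ContinuousLinearMap.id ℝ E) := by
      refine (hasMFDerivAt_id _).congr_of_eventuallyEq ?_
      filter_upwards [(isOpen_idComponent E G).mem_nhds (one_mem _)] with g hg
      exact congrArg Subtype.val (hr ⟨g, hg⟩)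
    exact hasMFDerivAt_unique h1 h2

theorem inclDeriv_AdModel (g : idComponent E G) (X : E) :
    inclDeriv E G (AdModel E g X) = AdModel E (g : G) (inclDeriv E G X) := by
  have h0 : HasMFDerivAt 𝓘(ℝ, E) 𝓘(ℝ, E) (Subtype.val : idComponent E G → G) (g * 1 * g⁻¹)
      (inclDeriv E G) := by
    rw [mul_one, mul_inv_cancel]; exact hasMFDerivAt_incl
  have h1 := HasMFDerivAt.comp (1 : idComponent E G) h0 (hasMFDerivAt_conj g)
  have h2 := HasMFDerivAt.comp (1 : idComponent E G) (hasMFDerivAt_conj (E := E) (g : G))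
    hasMFDerivAt_incl
  exact congrArg (fun T : E →L[ℝ] E ↦ T X) (hasMFDerivAt_unique h1 h2)

/-- The restriction to `G₀` of a 2-form on `G` is bi-invariant as soon as the 2-form is invariant
under translations by elements of `G₀`. -/
theorem pullback_incl_mem {η : TwoForm 𝓘(ℝ, E) G}
    (hη : ∀ g ∈ idComponent E G, pullback (smoothLeftMul 𝓘(ℝ, E) g) η = η ∧
      pullback (smoothRightMul 𝓘(ℝ, E) g) η = η) :
    pullback (idComponentIncl E G) η ∈ BiInvariantTwoForm 𝓘(ℝ, E) (idComponent E G) := by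
  intro g
  let ι := idComponentIncl E G
  constructor
  · rw [pullback_pullback _ ι ((smoothLeftMul 𝓘(ℝ, E) (g : G)).comp ι) (fun _ ↦ rfl),
      ← pullback_pullback ι (smoothLeftMul 𝓘(ℝ, E) (g : G)) _ (fun _ ↦ rfl), (hη g g.2).1]
  · rw [pullback_pullback _ ι ((smoothRightMul 𝓘(ℝ, E) (g : G)).comp ι) (fun _ ↦ rfl),
      ← pullback_pullback ι (smoothRightMul 𝓘(ℝ, E) (g : G)) _ (fun _ ↦ rfl), (hη g g.2).2]

end Inclusion

/-! ### The abelianisation and the forms it carries -/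

section Abelianisation
variable {E : Type*} [NormedAddCommGroup E] [NormedSpace ℝ E] [FiniteDimensional ℝ E]
  {G : Type*} [TopologicalSpace G] [ChartedSpace E G] [Group G] [LieGroup 𝓘(ℝ, E) ∞ G]

variable (E G) in
/-- The projection `q : 𝔤 → 𝔞`, with `𝔤` read as the model space `E`. -/
def abProj : E →ₗ[ℝ] LieAb 𝓘(ℝ, E) G := toLieAb 𝓘(ℝ, E) G

theorem abProj_surjective : Function.Surjective (abProj E G) :=
  LieSubmodule.Quotient.surjective_mk' (⁅(⊤ : LieIdeal ℝ (GroupLieAlgebra 𝓘(ℝ, E) G)),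
    (⊤ : LieIdeal ℝ (GroupLieAlgebra 𝓘(ℝ, E) G))⁆)

theorem abProj_lieModel (Z X : E) : abProj E G (lieModel G Z X) = 0 :=
  (LieSubmodule.Quotient.mk_eq_zero' (N := ⁅(⊤ : LieIdeal ℝ (GroupLieAlgebra 𝓘(ℝ, E) G)),
    (⊤ : LieIdeal ℝ (GroupLieAlgebra 𝓘(ℝ, E) G))⁆)).2
    (LieSubmodule.lie_mem_lie (LieSubmodule.mem_top _) (LieSubmodule.mem_top _))

theorem ker_abProj_le {W : Type*} [AddCommGroup W] [Module ℝ W] {f : E →ₗ[ℝ] W}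
    (hf : ∀ Z X, f (lieModel G Z X) = 0) : LinearMap.ker (abProj E G) ≤ LinearMap.ker f := by
  intro X hX
  have h1 : X ∈ (⁅(⊤ : LieIdeal ℝ (GroupLieAlgebra 𝓘(ℝ, E) G)),
    (⊤ : LieIdeal ℝ (GroupLieAlgebra 𝓘(ℝ, E) G))⁆).toSubmodule :=
    (LieSubmodule.Quotient.mk_eq_zero' (N := ⁅(⊤ : LieIdeal ℝ (GroupLieAlgebra 𝓘(ℝ, E) G)),
    (⊤ : LieIdeal ℝ (GroupLieAlgebra 𝓘(ℝ, E) G))⁆)).1 hX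
  rw [LieSubmodule.lieIdeal_oper_eq_linear_span'] at h1
  refine (Submodule.span_le (p := LinearMap.ker f)).2 ?_ h1
  rintro _ ⟨Z, -, Y, -, rfl⟩
  exact hf Z Y

/-- The universal property of the abelianisation. -/
theorem exists_comp_abProj {W : Type*} [AddCommGroup W] [Module ℝ W] {f : E →ₗ[ℝ] W}
    (hf : ∀ Z X, f (lieModel G Z X) = 0) :
    ∃ f' : LieAb 𝓘(ℝ, E) G →ₗ[ℝ] W, ∀ X, f' (abProj E G X) = f X := by
  have hs : Function.Surjective (abProj E G) := abProj_surjective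
  obtain ⟨s, hs⟩ := LinearMap.exists_rightInverse_of_surjective _ (LinearMap.range_eq_top.2 hs)
  refine ⟨f.comp s, fun X ↦ ?_⟩
  have h1 : s (abProj E G X) - X ∈ LinearMap.ker f := ker_abProj_le hf (by
    rw [LinearMap.mem_ker, map_sub, sub_eq_zero]
    exact LinearMap.congr_fun hs _)
  rwa [LinearMap.mem_ker, map_sub, sub_eq_zero] at h1

theorem lieAb_hom_ext {W : Type*} [AddCommGroup W] [Module ℝ W] {f f' : LieAb 𝓘(ℝ, E) G →ₗ[ℝ] W}
    (h : ∀ X, f (abProj E G X) = f' (abProj E G X)) : f = f' := by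
  ext v
  obtain ⟨X, rfl⟩ := abProj_surjective v
  exact h X

theorem exists_abAd (g : G) : ∃ f : LieAb 𝓘(ℝ, E) G →ₗ[ℝ] LieAb 𝓘(ℝ, E) G,
    ∀ X, f (abProj E G X) = abProj E G (AdModel E g X) :=
  exists_comp_abProj (f := (abProj E G).comp (AdModel E g : E →ₗ[ℝ] E)) fun Z X ↦ by
    simp [AdModel_lieModel, abProj_lieModel]

variable (E) in
/-- The endomorphism of `𝔞` induced by `Ad g`. -/
def abAd (g : G) : LieAb 𝓘(ℝ, E) G →ₗ[ℝ] LieAb 𝓘(ℝ, E) G := (exists_abAd g).choose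

theorem abAd_abProj (g : G) (X : E) : abAd E g (abProj E G X) = abProj E G (AdModel E g X) :=
  (exists_abAd g).choose_spec X

/-- `Ad(G₀)` acts trivially on `𝔞`. It suffices to test against linear functionals on `𝔞`. -/
theorem abProj_AdModel_of_mem_idComponent {g : G} (hg : g ∈ idComponent E G) (X : E) :
    abProj E G (AdModel E g X) = abProj E G X := by
  rw [← sub_eq_zero, ← Module.forall_dual_apply_eq_zero_iff ℝ]
  intro ℓ
  have := AdModel_apply_of_mem_idComponent
    (ℓ := LinearMap.toContinuousLinearMap (ℓ.comp (abProj E G)))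
    (fun Z X ↦ by simp [abProj_lieModel]) hg X
  simpa [sub_eq_zero] using this

variable (E G) in
/-- The representation of `π₀(G)` on `𝔞` induced by the adjoint action. -/
def componentRep : Representation ℝ (G ⧸ idComponent E G) (LieAb 𝓘(ℝ, E) G) :=
  QuotientGroup.lift (idComponent E G)
    { toFun := fun g ↦ (abAd E g : Module.End ℝ (LieAb 𝓘(ℝ, E) G))
      map_one' := lieAb_hom_ext fun X ↦ by
        rw [abAd_abProj, AdModel_one_apply]; rfl
      map_mul' := fun g h ↦ lieAb_hom_ext fun X ↦ by
        rw [Module.End.mul_apply, abAd_abProj, abAd_abProj, abAd_abProj, AdModel_mul_apply] }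
    fun g hg ↦ lieAb_hom_ext fun X ↦
      (abAd_abProj g X).trans (abProj_AdModel_of_mem_idComponent hg X)

theorem componentRep_abProj (g : G) (X : E) :
    componentRep E G (g : G ⧸ idComponent E G) (abProj E G X) = abProj E G (AdModel E g X) :=
  abAd_abProj g X

theorem update_pair {V : Type*} (a b c : V) : Function.update ![a, b] 1 c = ![a, c] := by
  ext i
  fin_cases i <;> rfl

/-- The bilinear form on `𝔤` obtained from an alternating form on `𝔞` by composing with `q`. -/
def pullForm : ((LieAb 𝓘(ℝ, E) G) [⋀^Fin 2]→ₗ[ℝ] ℝ) →ₗ[ℝ] (E →L[ℝ] E →L[ℝ] ℝ) where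
  toFun lam := LinearMap.toContinuousLinearMap
    (LinearMap.toContinuousLinearMap.toLinearMap.comp
      (LinearMap.mk₂ ℝ (fun X Y ↦ lam ![abProj E G X, abProj E G Y])
        (fun X X' Y ↦ by
          have := lam.map_vecCons_add ![abProj E G Y] (abProj E G X) (abProj E G X')
          rwa [map_add])
        (fun c X Y ↦ by
          have := lam.map_vecCons_smul ![abProj E G Y] c (abProj E G X)
          rwa [map_smul])
        (fun X Y Y' ↦ by
          have := lam.map_update_add ![abProj E G X, 0] 1 (abProj E G Y) (abProj E G Y')
          rwa [update_pair, update_pair, update_pair, ← map_add] at this)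
        (fun c X Y ↦ by
          have := lam.map_update_smul ![abProj E G X, 0] 1 c (abProj E G Y)
          rwa [update_pair, update_pair, ← map_smul] at this)))
  map_add' _ _ := rfl
  map_smul' _ _ := rfl

theorem pullForm_apply (lam : (LieAb 𝓘(ℝ, E) G) [⋀^Fin 2]→ₗ[ℝ] ℝ) (X Y : E) :
    pullForm lam X Y = lam ![abProj E G X, abProj E G Y] := rfl

theorem pullForm_self (lam : (LieAb 𝓘(ℝ, E) G) [⋀^Fin 2]→ₗ[ℝ] ℝ) (X : E) :
    pullForm lam X X = 0 :=
  lam.map_eq_zero_of_eq _ (i := 0) (j := 1) rfl (by simp)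

theorem pullForm_injective : Function.Injective (pullForm (E := E) (G := G)) := by
  intro lam lam' h
  ext v
  obtain ⟨X, hX⟩ := abProj_surjective (v 0)
  obtain ⟨Y, hY⟩ := abProj_surjective (v 1)
  have hv : v = ![abProj E G X, abProj E G Y] := by
    ext i; fin_cases i <;> simp [hX, hY]
  rw [hv, ← pullForm_apply, h, pullForm_apply]

/-- An `Ad(G₀)`-invariant alternating form on `𝔤` descends to `𝔞`. -/
theorem exists_pullForm_eq {β : E →L[ℝ] E →L[ℝ] ℝ} (hβ : ∀ X, β X X = 0)
    (hinv : ∀ g ∈ idComponent E G, ∀ X Y, β (AdModel E g X) (AdModel E g Y) = β X Y) :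
    ∃ lam : (LieAb 𝓘(ℝ, E) G) [⋀^Fin 2]→ₗ[ℝ] ℝ, pullForm lam = β := by
  have hl := map_lieModel_eq_zero_of_invariant hβ hinv
  have hr (Y X Z : E) : β Y (lieModel G X Z) = 0 := by
    have := hβ (Y + lieModel G X Z)
    simpa [hβ, hl] using this
  let c : (E →L[ℝ] ℝ) →ₗ[ℝ] (E →ₗ[ℝ] ℝ) := LinearMap.toContinuousLinearMap.symm.toLinearMap
  -- Descend to `𝔞` in one argument at a time; the arguments of `b` come out in swapped order.
  obtain ⟨b₁, hb₁⟩ := exists_comp_abProj (G := G) (f := c.comp β.toLinearMap) fun Z X ↦ by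
    ext Y; exact hl Z X Y
  obtain ⟨b, hb⟩ := exists_comp_abProj (G := G) (f := b₁.flip) fun Z X ↦ by
    refine lieAb_hom_ext (G := G) fun Y ↦ ?_
    rw [LinearMap.flip_apply, hb₁]
    exact hr Y Z X
  have hb' (X Y : E) : b (abProj E G Y) (abProj E G X) = β X Y := by
    rw [hb, LinearMap.flip_apply, hb₁]; rfl
  let lam : (LieAb 𝓘(ℝ, E) G) [⋀^Fin 2]→ₗ[ℝ] ℝ :=
    { toFun := fun v ↦ b (v 1) (v 0)
      map_update_add' := by
        intro inst v i x y
        rw [Subsingleton.elim inst (instDecidableEqFin 2)]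
        fin_cases i <;> simp
      map_update_smul' := by
        intro inst v i c x
        rw [Subsingleton.elim inst (instDecidableEqFin 2)]
        fin_cases i <;> simp
      map_eq_zero_of_eq' := by
        intro v i j h hij
        have h01 : v 1 = v 0 := by
          fin_cases i <;> fin_cases j <;> simp_all
        obtain ⟨X, hX⟩ := abProj_surjective (v 0)
        rw [h01, ← hX, hb', hβ] }
  refine ⟨lam, ?_⟩
  ext X Y
  exact hb' X Y

/-- `π₀(G)`-invariance of a form on `𝔞` is `Ad(G)`-invariance of the form it induces on `𝔤`. -/
theorem altRep_mem_invariants_iff (lam : (LieAb 𝓘(ℝ, E) G) [⋀^Fin 2]→ₗ[ℝ] ℝ) :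
    lam ∈ Representation.invariants (altRep (componentRep E G)) ↔
      ∀ (g : G) (X Y : E),
        pullForm lam (AdModel E g X) (AdModel E g Y) = pullForm lam X Y := by
  -- Stated at `g⁻¹` because `altRep` acts through the inverse.
  have key (g : G) : pullForm (altRep (componentRep E G) (g⁻¹ : G) lam) =
      (ContinuousLinearMap.precomp ℝ (AdModel E g)).comp
        ((pullForm lam).comp (AdModel E g)) := by
    ext X Y
    change lam (fun i ↦ componentRep E G (g⁻¹ : G ⧸ idComponent E G)⁻¹
      (![abProj E G X, abProj E G Y] i)) =
        lam ![abProj E G (AdModel E g X), abProj E G (AdModel E g Y)]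
    rw [inv_inv]
    congr 1
    ext i
    fin_cases i
    · exact componentRep_abProj g X
    · exact componentRep_abProj g Y
  rw [Representation.mem_invariants]
  constructor
  · intro h g X Y
    have := congrArg pullForm (h (g⁻¹ : G))
    rw [key] at this
    exact congrArg (fun β : E →L[ℝ] E →L[ℝ] ℝ ↦ β X Y) this
  · intro h γ
    obtain ⟨g, rfl⟩ := QuotientGroup.mk_surjective γ
    rw [← inv_inv g]
    refine pullForm_injective ((key _).trans ?_)
    ext X Y
    exact h g⁻¹ X Y

end Abelianisation

/-! ### Classification of bi-invariant 2-forms -/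

section Classification
variable {E : Type*} [NormedAddCommGroup E] [NormedSpace ℝ E] [FiniteDimensional ℝ E]
  {G : Type*} [TopologicalSpace G] [ChartedSpace E G] [Group G] [LieGroup 𝓘(ℝ, E) ∞ G]

/-- The left-invariant 2-form on `G` determined by an alternating form on `𝔞`. -/
def formOfAb : ((LieAb 𝓘(ℝ, E) G) [⋀^Fin 2]→ₗ[ℝ] ℝ) →ₗ[ℝ] TwoForm 𝓘(ℝ, E) G where
  toFun lam := leftInvForm (pullForm lam) (pullForm_self lam)
  map_add' _ _ := twoForm_ext fun _ _ _ ↦ rfl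
  map_smul' _ _ := twoForm_ext fun _ _ _ ↦ rfl

theorem formOfAb_mem {lam : (LieAb 𝓘(ℝ, E) G) [⋀^Fin 2]→ₗ[ℝ] ℝ}
    (h : lam ∈ Representation.invariants (altRep (componentRep E G))) :
    formOfAb lam ∈ BiInvariantTwoForm 𝓘(ℝ, E) G :=
  (leftInvForm_mem_iff _ (pullForm_self lam)).2 ((altRep_mem_invariants_iff lam).1 h)

theorem pullForm_AdModel_of_mem_idComponent (lam : (LieAb 𝓘(ℝ, E) G) [⋀^Fin 2]→ₗ[ℝ] ℝ)
    {g : G} (hg : g ∈ idComponent E G) (X Y : E) :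
    pullForm lam (AdModel E g X) (AdModel E g Y) = pullForm lam X Y := by
  rw [pullForm_apply, pullForm_apply, abProj_AdModel_of_mem_idComponent hg,
    abProj_AdModel_of_mem_idComponent hg]

theorem pullback_incl_formOfAb_mem (lam : (LieAb 𝓘(ℝ, E) G) [⋀^Fin 2]→ₗ[ℝ] ℝ) :
    pullback (idComponentIncl E G) (formOfAb lam) ∈
      BiInvariantTwoForm 𝓘(ℝ, E) (idComponent E G) :=
  pullback_incl_mem fun g hg ↦ ⟨pullback_smoothLeftMul_leftInvForm _
    (pullForm_self lam) g, twoForm_ext fun x v w ↦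
    (pullback_smoothRightMul_leftInvForm_apply _ (pullForm_self lam) g x v w).trans
      (pullForm_AdModel_of_mem_idComponent lam (inv_mem hg) _ _)⟩

variable (E G) in
/-- The map sending a `π₀(G)`-invariant form on `𝔞` to the bi-invariant 2-form on `G` it
determines. -/
def invariantsToForms : Representation.invariants (altRep (componentRep E G)) →ₗ[ℝ]
    BiInvariantTwoForm 𝓘(ℝ, E) G :=
  formOfAb.restrict fun _ h ↦ formOfAb_mem h

variable (E G) in
/-- The map sending a form on `𝔞` to the bi-invariant 2-form on `G₀` it determines, constructed as
the restriction to `G₀` of a left-invariant 2-form on `G`. -/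
def altToForms : ((LieAb 𝓘(ℝ, E) G) [⋀^Fin 2]→ₗ[ℝ] ℝ) →ₗ[ℝ]
    BiInvariantTwoForm 𝓘(ℝ, E) (idComponent E G) :=
  ((pullback (idComponentIncl E G)).comp formOfAb).codRestrict _ pullback_incl_formOfAb_mem

theorem formAtOne_invariantsToForms
    (lam : Representation.invariants (altRep (componentRep E G))) :
    formAtOne (invariantsToForms E G lam).1 = pullForm lam.1 :=
  formAtOne_leftInvForm _ (pullForm_self lam.1)

theorem formAtOne_altToForms (lam : (LieAb 𝓘(ℝ, E) G) [⋀^Fin 2]→ₗ[ℝ] ℝ) (X Y : E) :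
    formAtOne (altToForms E G lam).1 X Y =
      pullForm lam (inclDeriv E G X) (inclDeriv E G Y) :=
  congrArg (fun β : E →L[ℝ] E →L[ℝ] ℝ ↦ β (inclDeriv E G X) (inclDeriv E G Y))
    (formAtOne_leftInvForm (G := G) (pullForm lam) (pullForm_self lam))

theorem restrict_invariantsToForms (lam : Representation.invariants (altRep (componentRep E G))) :
    restrict E G (invariantsToForms E G lam) = altToForms E G lam.1 := rfl

theorem invariantsToForms_bijective : Function.Bijective (invariantsToForms E G) := by
  constructor
  · intro lam lam' h
    refine Subtype.ext (pullForm_injective ?_)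
    rw [← formAtOne_invariantsToForms, h, formAtOne_invariantsToForms]
  · intro η
    have hinv := formAtOne_AdModel η.2
    obtain ⟨lam, hlam⟩ := exists_pullForm_eq (formAtOne_self η.1) fun g _ ↦ hinv g
    refine ⟨⟨lam, (altRep_mem_invariants_iff lam).2 (by rwa [hlam])⟩, Subtype.ext ?_⟩
    refine eq_of_formAtOne_eq (Subtype.prop _) η.2 ?_
    rw [formAtOne_invariantsToForms, hlam]

theorem altToForms_bijective : Function.Bijective (altToForms E G) := by
  obtain ⟨R, hR, hR'⟩ := exists_inclDeriv_inverse E G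
  have hR (X : E) : R (inclDeriv E G X) = X := congrArg (fun T : E →L[ℝ] E ↦ T X) hR
  have hR' (X : E) : inclDeriv E G (R X) = X := congrArg (fun T : E →L[ℝ] E ↦ T X) hR'
  constructor
  · intro lam lam' h
    refine pullForm_injective ?_
    ext X Y
    have := congrArg (fun η ↦ formAtOne (Subtype.val η) (R X) (R Y)) h
    simpa only [formAtOne_altToForms, hR'] using this
  · intro η
    have hinv := formAtOne_AdModel η.2
    let β : E →L[ℝ] E →L[ℝ] ℝ := (ContinuousLinearMap.precomp ℝ R).comp ((formAtOne η.1).comp R)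
    have hβ (X Y : E) : β X Y = formAtOne η.1 (R X) (R Y) := rfl
    have hRAd (g : idComponent E G) (X : E) : R (AdModel E (g : G) X) = AdModel E g (R X) := by
      rw [← hR (AdModel E g (R X)), inclDeriv_AdModel, hR']
    obtain ⟨lam, hlam⟩ := exists_pullForm_eq (G := G) (β := β) (fun X ↦ formAtOne_self η.1 _)
      fun g hg X Y ↦ by
        rw [hβ, hβ, hRAd ⟨g, hg⟩, hRAd ⟨g, hg⟩, hinv]
    refine ⟨lam, Subtype.ext (eq_of_formAtOne_eq (Subtype.prop _) η.2 ?_)⟩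
    ext X Y
    rw [formAtOne_altToForms, hlam, hβ, hR, hR]

end Classification

end BiInv

end

theorem mainTheorem7 {E : Type*} [NormedAddCommGroup E] [NormedSpace ℝ E] [FiniteDimensional ℝ E]
    {G : Type*} [TopologicalSpace G] [ChartedSpace E G] [Group G] [LieGroup 𝓘(ℝ, E) ∞ G] :
    ∃ ρ : Representation ℝ (G ⧸ BiInv.idComponent E G) (BiInv.LieAb 𝓘(ℝ, E) G),
      (∀ (g : G) (X : GroupLieAlgebra 𝓘(ℝ, E) G),
        ρ (g : G ⧸ BiInv.idComponent E G) (BiInv.toLieAb 𝓘(ℝ, E) G X) =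
          BiInv.toLieAb 𝓘(ℝ, E) G (BiInv.Ad 𝓘(ℝ, E) g X)) ∧
      ∃ (Φ : BiInv.BiInvariantTwoForm 𝓘(ℝ, E) G ≃ₗ[ℝ]
            Representation.invariants (BiInv.altRep ρ))
        (Φ₀ : BiInv.BiInvariantTwoForm 𝓘(ℝ, E) (BiInv.idComponent E G) ≃ₗ[ℝ]
            (BiInv.LieAb 𝓘(ℝ, E) G) [⋀^Fin 2]→ₗ[ℝ] ℝ),
        (∀ (η : BiInv.BiInvariantTwoForm 𝓘(ℝ, E) G) (X Y : GroupLieAlgebra 𝓘(ℝ, E) G),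
          (Φ η).1 ![BiInv.toLieAb 𝓘(ℝ, E) G X, BiInv.toLieAb 𝓘(ℝ, E) G Y] = η.1.1 1 X Y) ∧
        (∀ (η : BiInv.BiInvariantTwoForm 𝓘(ℝ, E) (BiInv.idComponent E G))
            (X Y : GroupLieAlgebra 𝓘(ℝ, E) (BiInv.idComponent E G)),
          Φ₀ η
            ![BiInv.toLieAb 𝓘(ℝ, E) G (mfderiv 𝓘(ℝ, E) 𝓘(ℝ, E) (BiInv.idComponentIncl E G) 1 X),
              BiInv.toLieAb 𝓘(ℝ, E) G (mfderiv 𝓘(ℝ, E) 𝓘(ℝ, E) (BiInv.idComponentIncl E G) 1 Y)] =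
            η.1.1 1 X Y) ∧
        ∀ η : BiInv.BiInvariantTwoForm 𝓘(ℝ, E) G, Φ₀ (BiInv.restrict E G η) = (Φ η).1 := by
  let Ψ := LinearEquiv.ofBijective (BiInv.invariantsToForms E G) BiInv.invariantsToForms_bijective
  let Ψ₀ := LinearEquiv.ofBijective (BiInv.altToForms E G) BiInv.altToForms_bijective
  refine ⟨BiInv.componentRep E G, fun g X ↦ BiInv.componentRep_abProj (E := E) g X, Ψ.symm, Ψ₀.symm,
    fun η X Y ↦ ?_, fun η X Y ↦ ?_, fun η ↦ ?_⟩
  · obtain ⟨lam, rfl⟩ := Ψ.surjective η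
    rw [LinearEquiv.symm_apply_apply]
    exact (congrArg (fun β : E →L[ℝ] E →L[ℝ] ℝ ↦ β X Y)
      (BiInv.formAtOne_invariantsToForms lam)).symm
  · obtain ⟨lam, rfl⟩ := Ψ₀.surjective η
    rw [LinearEquiv.symm_apply_apply]
    exact (BiInv.formAtOne_altToForms lam X Y).symm
  · obtain ⟨lam, rfl⟩ := Ψ.surjective η
    rw [LinearEquiv.symm_apply_apply, LinearEquiv.symm_apply_eq]
    exact BiInv.restrict_invariantsToForms lam
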